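/- Let $a(x)=\sinh(x+\gamma)$, $b(x)=\sinh x$, $c=\sinh\gamma$ with $\gamma\in\mathbb C$, and let $\mathcal R(x)$ be the six-vertex $R$-matrix on $\mathbb C^2\otimes\mathbb C^2$ with rows $(a,0,0,0)$, $(0,b,c,0)$, $(0,c,b,0)$, $(0,0,0,a)$. For $\mu_1,\dots,\mu_L\in\mathbb C$ let $\mathcal R_{a1}(\lambda-\mu_1)\cdots\mathcal R_{aL}(\lambda-\mu_L)=\begin{pmatrix}A(\lambda)&B(\lambda)\\ C(\lambda)&D(\lambda)\end{pmatrix}$ be the monodromy matrix, let $|0\rangle=\binom10^{\otimes L}$, and let $$S_n(\lambda_1^C,\dots,\lambda_n^C|\lambda_1^B,\dots,\lambda_n^B)=\langle 0|\prod_{i=1}^nC(\lambda_i^C)\prod_{i=1}^nB(\lambda_i^B)|0\rangle .$$ For $n\le L$ define $$H(w|\bar w)=(-1)^{Ln+\frac{n(n+1)}2}c^{2n}\,\frac{\prod_{i<j}b(w_i-w_j)^2\,b(\bar w_i-\bar w_j)^2\,a(w_j-\mu_i)\,a(\bar w_j-\mu_i)}{\prod_{i=1}^n b(w_i-\mu_i)\,b(\bar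 w_i-\mu_i)}\prod_{i=1}^nR_i^{-1}\Lambda_i ,$$ $$R_i=\prod_{k=i}^n\frac{a(w_k-\mu_i)}{b(w_k-\mu_i)}-\prod_{k=i}^n\frac{a(\bar w_k-\mu_i)}{b(\bar w_k-\mu_i)},$$ $$\Lambda_i=\prod_{k=i}^La(\bar w_i-\mu_k)b(\mu_k-w_i)\prod_{k=i+1}^n\frac{a(w_i-w_k)}{b(w_i-w_k)}\frac{a(\bar w_k-\bar w_i)}{b(\bar w_k-\bar w_i)}-\prod_{k=i}^La(w_i-\mu_k)b(\mu_k-\bar w_i)\prod_{k=i+1}^n\frac{a(w_k-w_i)}{b(w_k-w_i)}\frac{a(\bar w_i-\bar w_k)}{b(\bar w_i-\bar w_k)} .$$ **(1) Integral formula.** For $n\le L$ and all $\mu,\lambda^C,\lambda^B$, $$S_n(\lambda^C|\lambda^B)=\oint\!\cdots\!\oint\prod_{i=1}^n\frac{dw_i}{2\pi i}\frac{d\bar w_i}{2\pi i}\;\frac{H(w_1,\dots,w_n|\bar w_1,\dots,\bar w_n)}{\prod_{i,j=1}^nb(w_i-\lambda_j^C)\,b(\bar w_i-\lambda_j^B)}$$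 for any contours (finite unions of positively oriented circles bounding disjoint closed discs, possibly different for the different variables) such that every $w_i$-contour encloses all $\lambda^C_j$, every $\bar w_i$-contour encloses all $\lambda_j^B$, and no other singularities of the integrand are enclosed. That is: the closed discs contain no zero of $b(w_i-\lambda_j^C)$, resp. $b(\bar w_i-\lambda_j^B)$, other than $\lambda_j^C$, resp. $\lambda_j^B$; on the contours the denominators $b(w_k-\mu_i)$, $b(\bar w_k-\mu_i)$ ($i\le k$) and $R_i$ of $H$ do not vanish; and $H$ extends holomorphically to a neighbourhood of the product of the closed discs. Such contours exist whenever $\lambda^C,\lambda^B$ are in generic position: no two $\lambda^C_j$ and no two $\lambda_j^B$ differ by a nonzero multiple of $i\pi$, and for every $i$ and all choices of $w_k\in\{\lambda_j^C\}$, $\bar w_k\in\{\lambda_j^B\}$ one has $\prod_{k=i}^n a(w_k-\mu_i)b(\bar w_k-\mu_i)\ne\prod_{k=i}^n a(\bar w_k-\mu_i)b(w_k-\mu_i)$. If $\sinh\gamma\ne0$, then for all $\mu$ generic position holds on a dense set of $(\lambda^C,\lambda^B)\in\mathbb C^{2n}$. **(2) Recursion for the kernel.** For $n=1$, $$H(w_1|\bar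 w_1)=c^2\,\frac{\prod_{k=1}^La(w_1-\mu_k)b(\bar w_1-\mu_k)-\prod_{k=1}^La(\bar w_1-\mu_k)b(w_1-\mu_k)}{b(w_1-\mu_1)b(\bar w_1-\mu_1)\Big[\frac{a(w_1-\mu_1)}{b(w_1-\mu_1)}-\frac{a(\bar w_1-\mu_1)}{b(\bar w_1-\mu_1)}\Big]} .$$ Let $\kappa=(-1)^{L-1}c^2\prod_{k=2}^La(\mu_1-\mu_k)a(\mu_k-\mu_1)$, and let $\bar H$ be $\kappa$ times the kernel for $n-1$, $L-1$ and $\mu_2,\dots,\mu_L$. For $1\le n\le L$, where the denominators do not vanish, $$H(w|\bar w)=\frac{\bar H(w_2,\dots,w_n|\bar w_2,\dots,\bar w_n)}{b(w_1-\mu_1)b(\bar w_1-\mu_1)}\prod_{k=2}^nb(w_1-w_k)^2b(\bar w_1-\bar w_k)^2\;\frac{\prod_{k=2}^na(w_k-\mu_1)a(\bar w_k-\mu_1)}{\prod_{k=2}^La(\mu_1-\mu_k)a(\mu_k-\mu_1)}\;R_1^{-1}\Lambda_1 .$$ **(3) Recursion for the scalar product.** For $1\le n\le L$ let $V(X|Y)$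 be $\kappa$ times the scalar product $S_{n-1}(X|Y)$ on $L-1$ sites with parameters $\mu_2,\dots,\mu_L$. Then $$S_n(\mu_1-\gamma,\lambda_2^C,\dots,\lambda_n^C|\mu_1,\lambda_2^B,\dots,\lambda_n^B)=\prod_{j=2}^nb(\lambda_j^C-\mu_1)a(\lambda_j^B-\mu_1)\;V(\lambda_2^C,\dots,\lambda_n^C|\lambda_2^B,\dots,\lambda_n^B),$$ and, where the denominators do not vanish, $$S_n(\lambda^C|\lambda^B)=\mathcal K\sum_{i,j=1}^n\Omega_{i,j}\,V\big((\lambda_k^C)_{k\ne i}\,\big|\,(\lambda^B_k)_{k\ne j}\big),$$ $$\mathcal K=\frac{\prod_{k=1}^na(\lambda_k^C-\mu_1)a(\lambda_k^B-\mu_1)}{\prod_{k=2}^La(\mu_1-\mu_k)a(\mu_k-\mu_1)}\Big[\prod_{k=1}^n\frac{a(\lambda_k^C-\mu_1)}{b(\lambda_k^C-\mu_1)}-\prod_{k=1}^n\frac{a(\lambda_k^B-\mu_1)}{b(\lambda_k^B-\mu_1)}\Big]^{-1},$$ $$\begin{aligned}\Omega_{i,j}=\;&\frac{1}{a(\lambda_i^C-\mu_1)b(\lambda_i^C-\mu_1)a(\lambda_j^B-\mu_1)b(\lambda_j^B-\mu_1)}\\&\times\Big[\prod_{k=1}^La(\lambda_j^B-\mu_k)b(\mu_k-\lambda_i^C)\prod_{k\ne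 i}\frac{a(\lambda_i^C-\lambda_k^C)}{b(\lambda_i^C-\lambda_k^C)}\prod_{k\ne j}\frac{a(\lambda_k^B-\lambda_j^B)}{b(\lambda_k^B-\lambda_j^B)}\\&\quad-\prod_{k=1}^La(\lambda_i^C-\mu_k)b(\mu_k-\lambda_j^B)\prod_{k\ne i}\frac{a(\lambda_k^C-\lambda_i^C)}{b(\lambda_k^C-\lambda_i^C)}\prod_{k\ne j}\frac{a(\lambda_j^B-\lambda_k^B)}{b(\lambda_j^B-\lambda_k^B)}\Big].\end{aligned}$$ -/

import Mathlib

open scoped BigOperators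

noncomputable section

namespace SixVertex

/-! ### The six-vertex model -/

/-- The Boltzmann weight `a(x) = sinh (x + γ)`. -/
def wtA (γ x : ℂ) : ℂ := Complex.sinh (x + γ)

/-- The Boltzmann weight `b(x) = sinh x`. -/
def wtB (x : ℂ) : ℂ := Complex.sinh x

/-- The Boltzmann weight `c = sinh γ`. -/
def wtC (γ : ℂ) : ℂ := Complex.sinh γ

/-- The R-matrix on `ℂ² ⊗ ℂ²`. In the ordered basis `(0,0), (0,1), (1,0), (1,1)` it has rows
`(a,0,0,0)`, `(0,b,c,0)`, `(0,c,b,0)`, `(0,0,0,a)`. -/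
def Rmat (γ x : ℂ) : Matrix (Fin 2 × Fin 2) (Fin 2 × Fin 2) ℂ := fun p q =>
  if p = q then (if p.1 = p.2 then wtA γ x else wtB x)
  else if p.1 = q.2 ∧ p.2 = q.1 then wtC γ else 0

/-- `R_{aj}(x)`: the R-matrix acting on the auxiliary space `V_a` and the `j`-th site of
`V_a ⊗ V_1 ⊗ ⋯ ⊗ V_L`, and as the identity on all other sites. The standard basis of
`V_1 ⊗ ⋯ ⊗ V_L` is indexed by `Fin L → Fin 2`. -/
def RmatAt (γ x : ℂ) {L : ℕ} (j : Fin L) :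
    Matrix (Fin 2 × (Fin L → Fin 2)) (Fin 2 × (Fin L → Fin 2)) ℂ := fun p q =>
  if ∀ k, k ≠ j → p.2 k = q.2 k then Rmat γ x (p.1, p.2 j) (q.1, q.2 j) else 0

/-- The monodromy matrix `R_{a1}(x - μ₁) R_{a2}(x - μ₂) ⋯ R_{aL}(x - μ_L)`. -/
def monodromy (γ : ℂ) {L : ℕ} (μ : Fin L → ℂ) (x : ℂ) :
    Matrix (Fin 2 × (Fin L → Fin 2)) (Fin 2 × (Fin L → Fin 2)) ℂ :=
  (List.ofFn fun j : Fin L => RmatAt γ (x - μ j) j).prod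

/-- The operator `B(x)`: the upper right block of the monodromy matrix in auxiliary space. -/
def opB (γ : ℂ) {L : ℕ} (μ : Fin L → ℂ) (x : ℂ) :
    Matrix (Fin L → Fin 2) (Fin L → Fin 2) ℂ := fun s t => monodromy γ μ x (0, s) (1, t)

/-- The operator `C(x)`: the lower left block of the monodromy matrix in auxiliary space. -/
def opC (γ : ℂ) {L : ℕ} (μ : Fin L → ℂ) (x : ℂ) :
    Matrix (Fin L → Fin 2) (Fin L → Fin 2) ℂ := fun s t => monodromy γ μ x (1, s) (0, t)

/-- The basis index of the reference state `|0⟩ = (1,0)ᵗ ⊗ ⋯ ⊗ (1,0)ᵗ`. -/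
def vac (L : ℕ) : Fin L → Fin 2 := fun _ => 0

/-- The off-shell scalar product
`S_n = ⟨0| C(λ₁^C) ⋯ C(λ_n^C) B(λ₁^B) ⋯ B(λ_n^B) |0⟩`, a diagonal matrix entry. -/
def scalarProduct (γ : ℂ) {L n : ℕ} (μ : Fin L → ℂ) (lamC lamB : Fin n → ℂ) : ℂ :=
  ((List.ofFn fun i => opC γ μ (lamC i)).prod * (List.ofFn fun i => opB γ μ (lamB i)).prod)
    (vac L) (vac L)

/-! ### The kernel `H` -/

/-- `R_i = ∏_{k=i}^n a(w_k - μ_i)/b(w_k - μ_i) - ∏_{k=i}^n a(w̄_k - μ_i)/b(w̄_k - μ_i)`. -/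
def Rfac (γ : ℂ) {L n : ℕ} (h : n ≤ L) (μ : Fin L → ℂ) (w v : Fin n → ℂ) (i : Fin n) : ℂ :=
  (∏ k ∈ Finset.Ici i, wtA γ (w k - μ (Fin.castLE h i)) / wtB (w k - μ (Fin.castLE h i)))
  - ∏ k ∈ Finset.Ici i, wtA γ (v k - μ (Fin.castLE h i)) / wtB (v k - μ (Fin.castLE h i))

/-- The factor `Λ_i`. The variables `w̄` are written `v`. -/
def Lfac (γ : ℂ) {L n : ℕ} (h : n ≤ L) (μ : Fin L → ℂ) (w v : Fin n → ℂ) (i : Fin n) : ℂ :=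
  (∏ k ∈ Finset.Ici (Fin.castLE h i), wtA γ (v i - μ k) * wtB (μ k - w i))
    * (∏ k ∈ Finset.Ioi i,
        (wtA γ (w i - w k) / wtB (w i - w k)) * (wtA γ (v k - v i) / wtB (v k - v i)))
  - (∏ k ∈ Finset.Ici (Fin.castLE h i), wtA γ (w i - μ k) * wtB (μ k - v i))
    * (∏ k ∈ Finset.Ioi i,
        (wtA γ (w k - w i) / wtB (w k - w i)) * (wtA γ (v i - v k) / wtB (v i - v k)))

/-- The closed formula for the kernel `H(w₁,…,w_n | w̄₁,…,w̄_n)`. -/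
def Hker (γ : ℂ) {L n : ℕ} (h : n ≤ L) (μ : Fin L → ℂ) (w v : Fin n → ℂ) : ℂ :=
  (-1) ^ (L * n + n * (n + 1) / 2) * wtC γ ^ (2 * n)
  * ((∏ i, ∏ j ∈ Finset.Ioi i,
        wtB (w i - w j) ^ 2 * wtB (v i - v j) ^ 2
          * wtA γ (w j - μ (Fin.castLE h i)) * wtA γ (v j - μ (Fin.castLE h i)))
      / ∏ i, wtB (w i - μ (Fin.castLE h i)) * wtB (v i - μ (Fin.castLE h i)))
  * ∏ i, (Rfac γ h μ w v i)⁻¹ * Lfac γ h μ w v i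

/-! ### Contours -/

/-- A contour: a finite union of positively oriented circles bounding disjoint closed discs. -/
structure Contour where
  /-- number of circles -/
  m : ℕ
  center : Fin m → ℂ
  radius : Fin m → ℝ
  radius_pos : ∀ j, 0 < radius j
  disjoint : Pairwise fun j k =>
    Disjoint (Metric.closedBall (center j) (radius j)) (Metric.closedBall (center k) (radius k))

/-- The points on the contour. -/
def Contour.trace (Γ : Contour) : Set ℂ := ⋃ j, Metric.sphere (Γ.center j) (Γ.radius j)

/-- The points enclosed by the contour. -/
def Contour.inside (Γ : Contour) : Set ℂ := ⋃ j, Metric.ball (Γ.center j) (Γ.radius j)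

/-- The points on the contour or enclosed by it. -/
def Contour.filled (Γ : Contour) : Set ℂ := ⋃ j, Metric.closedBall (Γ.center j) (Γ.radius j)

/-- The contour integral `∮_Γ f(z) dz / (2πi)`. -/
def Contour.integral (Γ : Contour) (f : ℂ → ℂ) : ℂ :=
  ∑ j, (2 * Real.pi * Complex.I)⁻¹ * circleIntegral f (Γ.center j) (Γ.radius j)

/-- The multiple contour integral `∮_{Γ₁} ⋯ ∮_{Γ_n} F(w₁,…,w_n) ∏ dw_i / (2πi)`. -/
def multiIntegral : {n : ℕ} → (Fin n → Contour) → ((Fin n → ℂ) → ℂ) → ℂ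
  | 0, _, F => F Fin.elim0
  | _ + 1, Γ, F =>
      (Γ 0).integral fun z => multiIntegral (fun i => Γ i.succ) fun w => F (Fin.cons z w)

/-- None of the denominators `b(w_k - μ_i)`, `b(w̄_k - μ_i)` (`i ≤ k`) and `R_i` of `H`
vanishes. -/
def DenomsNonzero (γ : ℂ) {L n : ℕ} (h : n ≤ L) (μ : Fin L → ℂ) (w v : Fin n → ℂ) : Prop :=
  (∀ i k, i ≤ k →
    wtB (w k - μ (Fin.castLE h i)) ≠ 0 ∧ wtB (v k - μ (Fin.castLE h i)) ≠ 0) ∧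
  ∀ i, Rfac γ h μ w v i ≠ 0

/-- The contour `Γ i` for `w_i` and the contour `Δ i` for `w̄_i` are such that `w_i`-contours
enclose, among the singularities of `H / ∏ b(w_i - λ_j^C) b(w̄_i - λ_j^B)`, only the poles
`w_i = λ_j^C`, and `w̄_i`-contours only the poles `w̄_i = λ_j^B`.

The factors `1 / b(w_i - w_k)` inside `Λ_i` are cancelled by the squares in the numerator of
`H`, so that they produce no singularity; in the last clause points where they vanish are
left out of the comparison of `H` with its holomorphic extension. -/
structure Admissible (γ : ℂ) {L n : ℕ} (h : n ≤ L) (μ : Fin L → ℂ) (lamC lamB : Fin n → ℂ)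
    (Γ Δ : Fin n → Contour) : Prop where
  /-- every `w_i`-contour encloses all the poles `λ_j^C` -/
  mem_C : ∀ i j, lamC j ∈ (Γ i).inside
  /-- every `w̄_i`-contour encloses all the poles `λ_j^B` -/
  mem_B : ∀ i j, lamB j ∈ (Δ i).inside
  /-- no other zeros `λ_j^C + iπm` of `b(w_i - λ_j^C)` are enclosed -/
  only_C : ∀ i, ∀ z ∈ (Γ i).filled, ∀ j, wtB (z - lamC j) = 0 → z = lamC j
  /-- no other zeros `λ_j^B + iπm` of `b(w̄_i - λ_j^B)` are enclosed -/
  only_B : ∀ i, ∀ z ∈ (Δ i).filled, ∀ j, wtB (z - lamB j) = 0 → z = lamB j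
  /-- the contours avoid the zeros of the denominators of `H` -/
  on_contour : ∀ w v : Fin n → ℂ, (∀ i, w i ∈ (Γ i).trace) → (∀ i, v i ∈ (Δ i).trace) →
    DenomsNonzero γ h μ w v
  /-- `H` has no singularities (other than removable ones) on the enclosed region -/
  holomorphic : ∃ G : (Fin n → ℂ) × (Fin n → ℂ) → ℂ,
    AnalyticOnNhd ℂ G {p | (∀ i, p.1 i ∈ (Γ i).filled) ∧ ∀ i, p.2 i ∈ (Δ i).filled} ∧
    ∀ w v : Fin n → ℂ, (∀ i, w i ∈ (Γ i).filled) → (∀ i, v i ∈ (Δ i).filled) →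
      DenomsNonzero γ h μ w v →
      (∀ i k, i ≠ k → wtB (w i - w k) ≠ 0 ∧ wtB (v i - v k) ≠ 0) →
      G (w, v) = Hker γ h μ w v

/-- Generic position of `λ^C, λ^B`: no two `λ_j^C` (no two `λ_j^B`) differ by a nonzero
multiple of `iπ`, and for all choices of `w_k` among the `λ_j^C` and of `w̄_k` among the
`λ_j^B`, all `R_i`, multiplied by their denominators, are nonzero. -/
def Generic (γ : ℂ) {L n : ℕ} (h : n ≤ L) (μ : Fin L → ℂ) (lamC lamB : Fin n → ℂ) : Prop :=
  (∀ j k, wtB (lamC j - lamC k) = 0 → lamC j = lamC k) ∧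
  (∀ j k, wtB (lamB j - lamB k) = 0 → lamB j = lamB k) ∧
  ∀ (f g : Fin n → Fin n) (i : Fin n),
    (∏ k ∈ Finset.Ici i, wtA γ (lamC (f k) - μ (Fin.castLE h i))
        * wtB (lamB (g k) - μ (Fin.castLE h i)))
    - (∏ k ∈ Finset.Ici i, wtA γ (lamB (g k) - μ (Fin.castLE h i))
        * wtB (lamC (f k) - μ (Fin.castLE h i))) ≠ 0

/-! ### The recursion -/

/-- The constant by which `V` differs from `S_{n-1}`, and `H̄` from the kernel for `n - 1`
(there are `L + 1` sites). -/
def recConst (γ : ℂ) {L : ℕ} (μ : Fin (L + 1) → ℂ) : ℂ :=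
  (-1) ^ L * wtC γ ^ 2 * ∏ k : Fin L, wtA γ (μ 0 - μ k.succ) * wtA γ (μ k.succ - μ 0)

/-- The function `V`: a constant times the scalar product `S_n` for the sites `2, …, L + 1`. -/
def Vfun (γ : ℂ) {L n : ℕ} (μ : Fin (L + 1) → ℂ) (X Y : Fin n → ℂ) : ℂ :=
  recConst γ μ * scalarProduct γ (fun k => μ (Fin.succ k)) X Y

/-- The function `H̄`: a constant times the kernel `H` for the sites `2, …, L + 1`. -/
def Hbar (γ : ℂ) {L n : ℕ} (h : n ≤ L) (μ : Fin (L + 1) → ℂ) (w v : Fin n → ℂ) : ℂ :=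
  recConst γ μ * Hker γ h (fun k => μ (Fin.succ k)) w v

/-- `∏_k a(w_k - μ₁)/b(w_k - μ₁) - ∏_k a(w̄_k - μ₁)/b(w̄_k - μ₁)`. -/
def Ffac (γ : ℂ) {L n : ℕ} (μ : Fin (L + 1) → ℂ) (w v : Fin n → ℂ) : ℂ :=
  (∏ k, wtA γ (w k - μ 0) / wtB (w k - μ 0)) - ∏ k, wtA γ (v k - μ 0) / wtB (v k - μ 0)

/-- The prefactor `𝒦` of the recursion. -/
def Kfac (γ : ℂ) {L n : ℕ} (μ : Fin (L + 1) → ℂ) (lamC lamB : Fin n → ℂ) : ℂ :=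
  ((∏ k, wtA γ (lamC k - μ 0) * wtA γ (lamB k - μ 0))
    / ∏ k : Fin L, wtA γ (μ 0 - μ k.succ) * wtA γ (μ k.succ - μ 0))
  * (Ffac γ μ lamC lamB)⁻¹

/-- The coefficient `Ω_{i,j}` of the recursion. -/
def Omega (γ : ℂ) {L n : ℕ} (μ : Fin (L + 1) → ℂ) (lamC lamB : Fin n → ℂ) (i j : Fin n) : ℂ :=
  1 / (wtA γ (lamC i - μ 0) * wtB (lamC i - μ 0) * wtA γ (lamB j - μ 0) * wtB (lamB j - μ 0))
  * ((∏ k, wtA γ (lamB j - μ k) * wtB (μ k - lamC i))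
      * (∏ k ∈ Finset.univ.erase i, wtA γ (lamC i - lamC k) / wtB (lamC i - lamC k))
      * (∏ k ∈ Finset.univ.erase j, wtA γ (lamB k - lamB j) / wtB (lamB k - lamB j))
    - (∏ k, wtA γ (lamC i - μ k) * wtB (μ k - lamB j))
      * (∏ k ∈ Finset.univ.erase i, wtA γ (lamC k - lamC i) / wtB (lamC k - lamC i))
      * (∏ k ∈ Finset.univ.erase j, wtA γ (lamB j - lamB k) / wtB (lamB j - lamB k)))

end SixVertex

end

open SixVertex

/-!
The matrix element `⟨0| C(λ₁^C) ⋯ C(λ_n^C) A(μ₁) B(λ₁^B) ⋯ B(λ_n^B) |0⟩` is evaluated in two ways,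
by moving `A(μ₁)` to the left through the operators `C` and to the right through the operators `B`.
This expresses the scalar product `S_n` through scalar products in which one of the arguments is
`μ₁`. In these one argument of the opposite kind is traded for `μ₁ - γ`: the operator `D(μ₁ - γ)`
annihilates a Bethe vector with the argument `μ₁`, so that expanding its action on the other Bethe
vector gives a linear relation. Once both `μ₁` and `μ₁ - γ` occur as arguments, the first site
decouples and leaves `S_{n-1}` on the remaining sites. The outcome is the recursion for `S_n`.

The kernel is a quotient of entire functions whose recursion matches that of the scalar product, so
iterating the latter writes `S_n` as a sum, over all ways to substitute `λ^C` for `w` and `λ^B` for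
`w̄`, of the residues of the integrand. For `λ^C, λ^B` outside the zero sets of finitely many
nontrivial analytic functions this proves the integral formula. The complement of these zero sets
is dense, and both sides are continuous in `λ^C, λ^B` once the kernel is replaced by its
holomorphic extension, which proves it in general.
-/

noncomputable section

namespace SixVertex

/-- Operators on `V_1 ⊗ ⋯ ⊗ V_L`, as matrices in the standard basis. -/
abbrev Op (L : ℕ) : Type := Matrix (Fin L → Fin 2) (Fin L → Fin 2) ℂ

/-- The tensor product of an operator on the first site and an operator on the remaining sites,
transported from pairs of indices to tuples. -/
def tens {L : ℕ} : Matrix (Fin 2) (Fin 2) ℂ →ₗ[ℂ] Op L →ₗ[ℂ] Op (L + 1) :=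
  LinearMap.compr₂ (Matrix.kroneckerBilinear (R := ℂ) (α := ℂ))
    (Matrix.reindexLinearEquiv ℂ ℂ (Fin.consEquiv fun _ => Fin 2)
      (Fin.consEquiv fun _ => Fin 2)).toLinearMap

section tens
variable {L : ℕ}

@[simp]
lemma tens_apply (X : Matrix (Fin 2) (Fin 2) ℂ) (Y : Op L) (s t : Fin (L + 1) → Fin 2) :
    tens X Y s t = X (s 0) (t 0) * Y (Fin.tail s) (Fin.tail t) := rfl

lemma tens_mul_tens (X X' : Matrix (Fin 2) (Fin 2) ℂ) (Y Y' : Op L) :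
    tens X Y * tens X' Y' = tens (X * X') (Y * Y') :=
  (Matrix.submatrix_mul_equiv _ _ _ _ _).trans
    (congrArg (Matrix.reindex _ _) (Matrix.mul_kronecker_mul X X' Y Y').symm)

lemma tens_one_one : tens 1 (1 : Op L) = 1 :=
  (congrArg (Matrix.reindex _ _) Matrix.one_kronecker_one).trans (Matrix.submatrix_one_equiv _)

/-- The extension of an operator by the identity on a new first site. -/
def oneTens : Op L →+* Op (L + 1) where
  toFun := tens 1
  map_zero' := map_zero _
  map_add' := map_add _
  map_one' := tens_one_one
  map_mul' Y Y' := by rw [tens_mul_tens, one_mul]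

lemma tens_mul_oneTens (X : Matrix (Fin 2) (Fin 2) ℂ) (Y : Op L) :
    tens X 1 * oneTens Y = tens X Y :=
  (tens_mul_tens X 1 1 Y).trans (by rw [mul_one, one_mul])

end tens

/-- The block of the R-matrix at the entry `(a, b)` of its first tensor factor. -/
def site (γ x : ℂ) : Matrix (Fin 2) (Fin 2) (Matrix (Fin 2) (Fin 2) ℂ) :=
  (Matrix.compRingEquiv (Fin 2) (Fin 2) ℂ).symm (Rmat γ x)

/-- The monodromy matrix as a `2 × 2` matrix of operators, with rows `(A, B)` and `(C, D)`. -/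
def block (γ : ℂ) {L : ℕ} (μ : Fin L → ℂ) (x : ℂ) : Matrix (Fin 2) (Fin 2) (Op L) :=
  (Matrix.compRingEquiv (Fin 2) (Fin L → Fin 2) ℂ).symm (monodromy γ μ x)

lemma compRingEquiv_symm_RmatAt_zero (γ x : ℂ) {L : ℕ} :
    (Matrix.compRingEquiv (Fin 2) (Fin (L + 1) → Fin 2) ℂ).symm (RmatAt γ x 0) =
      (site γ x).map fun X => tens X 1 := by
  ext a b s t
  have htail : (∀ k : Fin L, s k.succ = t k.succ) ↔ Fin.tail s = Fin.tail t := funext_iff.symm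
  by_cases h : Fin.tail s = Fin.tail t <;>
    simp [RmatAt, site, Fin.forall_fin_succ, htail, h, Matrix.one_apply]

lemma compRingEquiv_symm_RmatAt_succ (γ x : ℂ) {L : ℕ} (j : Fin L) :
    (Matrix.compRingEquiv (Fin 2) (Fin (L + 1) → Fin 2) ℂ).symm (RmatAt γ x j.succ) =
      oneTens.mapMatrix ((Matrix.compRingEquiv (Fin 2) (Fin L → Fin 2) ℂ).symm (RmatAt γ x j)) := by
  ext a b s t
  by_cases h : s 0 = t 0 <;>
    simp only [RmatAt, oneTens, Fin.forall_fin_succ, Fin.tail, h, (Fin.succ_ne_zero j).symm,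
      Matrix.one_apply, Matrix.compRingEquiv_symm_apply, Matrix.comp_symm_apply,
      RingHom.mapMatrix_apply, Matrix.map_apply, RingHom.coe_mk, MonoidHom.coe_mk, OneHom.coe_mk,
      tens_apply, ne_eq, not_false_eq_true, forall_const, true_and, false_and, if_true, if_false,
      one_mul, zero_mul, Fin.succ_inj]
  congr

lemma block_succ (γ : ℂ) {L : ℕ} (μ : Fin (L + 1) → ℂ) (x : ℂ) (a b : Fin 2) :
    block γ μ x a b =
      ∑ c, tens (site γ (x - μ 0) a c) (block γ (fun k => μ k.succ) x c b) := by
  have hprod : block γ μ x = (site γ (x - μ 0)).map (fun X => tens X 1) *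
      oneTens.mapMatrix (block γ (fun k => μ k.succ) x) := by
    simp only [block, monodromy, List.ofFn_succ, List.prod_cons, map_mul, map_list_prod,
      List.map_ofFn, compRingEquiv_symm_RmatAt_zero]
    congr 3
    funext j
    exact compRingEquiv_symm_RmatAt_succ γ _ j
  simp only [hprod, Matrix.mul_apply, Matrix.map_apply, RingHom.mapMatrix_apply, tens_mul_oneTens]

lemma block_zero (γ : ℂ) (μ : Fin 0 → ℂ) (x : ℂ) : block γ μ x = 1 := by
  simp only [block, monodromy, List.ofFn_zero, List.prod_nil, map_one]

section yangBaxter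
variable (γ : ℂ)

lemma wtA_sub_mul_wtB (x y : ℂ) :
    wtA γ (x - y) * wtB x = wtB (x - y) * wtA γ x + wtC γ * wtB y := by
  simp only [wtA, wtB, wtC, Complex.sinh_add, Complex.sinh_sub, Complex.cosh_sub]
  linear_combination (Complex.sinh γ * Complex.sinh y) * Complex.cosh_sq x

lemma wtA_sub_mul_wtA (x y : ℂ) :
    wtA γ (x - y) * wtA γ y = wtB (x - y) * wtB y + wtC γ * wtA γ x := by
  obtain ⟨u, rfl⟩ : ∃ u, x = u + y := ⟨x - y, by ring⟩
  simp only [wtA, wtB, wtC, add_sub_cancel_right, Complex.sinh_add, Complex.cosh_add]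
  linear_combination (Complex.sinh u * Complex.sinh y) * Complex.cosh_sq γ

lemma site_yangBaxter (x y : ℂ) (a b e f : Fin 2) :
    ∑ c, ∑ d, Rmat γ (x - y) (a, b) (c, d) • (site γ x c e * site γ y d f) =
      ∑ c, ∑ d, Rmat γ (x - y) (c, d) (e, f) • (site γ y b d * site γ x a c) := by
  have hB := wtA_sub_mul_wtB γ x y
  have hA := wtA_sub_mul_wtA γ x y
  have hAB : wtA γ y * wtB x = wtA γ x * wtB y + wtC γ * wtB (x - y) := by
    simp only [wtA, wtB, wtC, Complex.sinh_add, Complex.sinh_sub]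
    ring
  ext s t
  simp only [Fin.sum_univ_two, Matrix.add_apply, Matrix.smul_apply, Matrix.mul_apply, site,
    Matrix.compRingEquiv_symm_apply, Matrix.comp_symm_apply]
  fin_cases a <;> fin_cases b <;> fin_cases e <;> fin_cases f <;> fin_cases s <;>
    fin_cases t <;>
    simp only [Rmat, Fin.zero_eta, Fin.mk_one, Prod.mk.injEq, zero_ne_one, one_ne_zero, and_true,
      and_false, and_self, ↓reduceIte, zero_mul, mul_zero, add_zero, zero_add, smul_eq_mul] <;>
    first
    | ring1
    | linear_combination wtC γ * hB
    | linear_combination wtC γ * hA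
    | linear_combination wtC γ * hAB
    | linear_combination -wtC γ * hB
    | linear_combination -wtC γ * hA
    | linear_combination -wtC γ * hAB

lemma block_mul_block_succ {L : ℕ} (μ : Fin (L + 1) → ℂ) (x y : ℂ) (a b c d : Fin 2) :
    block γ μ x a b * block γ μ y c d = ∑ e, ∑ f,
      tens (site γ (x - μ 0) a e * site γ (y - μ 0) c f)
        (block γ (fun k => μ k.succ) x e b * block γ (fun k => μ k.succ) y f d) := by
  simp only [block_succ γ μ, Finset.sum_mul_sum, tens_mul_tens]

theorem block_yangBaxter {L : ℕ} (μ : Fin L → ℂ) (x y : ℂ) (a b a' b' : Fin 2) :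
    ∑ c, ∑ d, Rmat γ (x - y) (a, b) (c, d) • (block γ μ x c a' * block γ μ y d b') =
      ∑ c, ∑ d, Rmat γ (x - y) (c, d) (a', b') • (block γ μ y b d * block γ μ x a c) := by
  induction L generalizing a b a' b' with
  | zero => simp [block_zero, Matrix.one_apply]
  | succ L ih =>
    have hsite (e f : Fin 2) := site_yangBaxter γ (x - μ 0) (y - μ 0) a b e f
    simp only [sub_sub_sub_cancel_right] at hsite
    set T := block γ (fun k => μ k.succ) with hT
    calc _ = ∑ e, ∑ f, tens (∑ c, ∑ d, Rmat γ (x - y) (a, b) (c, d) •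
            (site γ (x - μ 0) c e * site γ (y - μ 0) d f)) (T x e a' * T y f b') := by
          simp only [block_mul_block_succ, ← hT, Finset.smul_sum, map_sum, map_smul,
            LinearMap.sum_apply, LinearMap.smul_apply]
          simp only [Fin.sum_univ_two]
          abel
      _ = ∑ c, ∑ d, tens (site γ (y - μ 0) b d * site γ (x - μ 0) a c)
            (∑ e, ∑ f, Rmat γ (x - y) (c, d) (e, f) • (T x e a' * T y f b')) := by
          simp only [hsite, map_sum, map_smul, LinearMap.sum_apply,
            LinearMap.smul_apply]
          simp only [Fin.sum_univ_two]
          abel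
      _ = _ := by
          simp only [hT, ih, block_mul_block_succ, Finset.smul_sum, map_sum, map_smul]
          simp only [Fin.sum_univ_two]
          abel

end yangBaxter

section quantumDet

/-- The antisymmetric symbol on two indices, with `ε₀₁ = 1`. -/
def antisymm : Matrix (Fin 2) (Fin 2) ℂ := !![0, 1; -1, 0]

lemma site_quantumDet (γ x : ℂ) (a b : Fin 2) :
    site γ (x - γ) 0 a * site γ x 1 b - site γ (x - γ) 1 a * site γ x 0 b =
      (antisymm a b * (wtA γ x * wtB (x - γ))) • 1 := by
  have hshift : wtA γ (x - γ) = wtB x := congrArg Complex.sinh (sub_add_cancel x γ)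
  have hdet : wtB x * wtB x = wtB (x - γ) * wtA γ x + wtC γ * wtC γ := by
    simpa only [hshift, wtB, wtC] using wtA_sub_mul_wtB γ x γ
  ext s t
  simp only [Matrix.sub_apply, Matrix.smul_apply, Matrix.mul_apply, Fin.sum_univ_two, site,
    Matrix.compRingEquiv_symm_apply, Matrix.comp_symm_apply]
  fin_cases a <;> fin_cases b <;> fin_cases s <;> fin_cases t <;>
    simp only [Rmat, antisymm, hshift, Fin.zero_eta, Fin.mk_one, Prod.mk.injEq, Matrix.of_apply,
      Matrix.cons_val', Matrix.cons_val_zero, Matrix.cons_val_one, Matrix.cons_val_fin_one,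
      Matrix.one_apply_eq, Matrix.one_apply_ne, ne_eq, not_false_eq_true, zero_ne_one, one_ne_zero,
      and_true, and_false, and_self, ↓reduceIte, zero_mul, mul_zero, add_zero, zero_add,
      smul_eq_mul] <;>
    first
    | done
    | ring1
    | linear_combination hdet
    | linear_combination -hdet

theorem block_quantumDet (γ : ℂ) {L : ℕ} (μ : Fin L → ℂ) (x : ℂ) (a b : Fin 2) :
    block γ μ (x - γ) 0 a * block γ μ x 1 b - block γ μ (x - γ) 1 a * block γ μ x 0 b =
      (antisymm a b * ∏ k, wtA γ (x - μ k) * wtB (x - μ k - γ)) • 1 := by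
  induction L with
  | zero =>
    fin_cases a <;> fin_cases b <;> simp [block_zero, antisymm]
  | succ L ih =>
    set T := block γ (fun k => μ k.succ) with hT
    calc _ = ∑ e, ∑ f, tens (site γ (x - μ 0 - γ) 0 e * site γ (x - μ 0) 1 f -
            site γ (x - μ 0 - γ) 1 e * site γ (x - μ 0) 0 f) (T (x - γ) e a * T x f b) := by
          simp only [block_mul_block_succ, ← hT, map_sub, LinearMap.sub_apply,
            Finset.sum_sub_distrib, sub_right_comm x γ]
      _ = (wtA γ (x - μ 0) * wtB (x - μ 0 - γ)) •
            tens 1 (T (x - γ) 0 a * T x 1 b - T (x - γ) 1 a * T x 0 b) := by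
          simp only [site_quantumDet, map_smul, LinearMap.smul_apply, Fin.sum_univ_two, antisymm,
            map_sub, Matrix.of_apply, Matrix.cons_val_zero, Matrix.cons_val_one,
            Matrix.cons_val_fin_one]
          module
      _ = _ := by
          rw [ih, map_smul, tens_one_one, smul_smul, Fin.prod_univ_succ, mul_left_comm]

end quantumDet

lemma dense_ne_zero {E : Type*} [NormedAddCommGroup E] [NormedSpace ℂ E] {f : E → ℂ}
    (hf : AnalyticOnNhd ℂ f Set.univ) {x₀ : E} (h : f x₀ ≠ 0) : Dense {x | f x ≠ 0} := by
  change Dense {x | f x = 0}ᶜ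
  refine interior_eq_empty_iff_dense_compl.1 (Set.eq_empty_of_forall_notMem fun x hx => h ?_)
  exact hf.eqOn_zero_of_preconnected_of_eventuallyEq_zero isPreconnected_univ (Set.mem_univ x)
    (mem_interior_iff_mem_nhds.1 hx) (Set.mem_univ x₀)

lemma analyticAt_sinh (z : ℂ) : AnalyticAt ℂ Complex.sinh z :=
  Complex.differentiable_sinh.analyticAt z

lemma dense_wtA_sub_ne_zero (γ y : ℂ) : Dense {x | wtA γ (x - y) ≠ 0} := by
  refine dense_ne_zero (fun z _ => (analyticAt_sinh _).comp (by fun_prop))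
    (x₀ := y - γ + Real.pi / 2 * Complex.I) ?_
  have hx₀ : y - γ + Real.pi / 2 * Complex.I - y + γ = Real.pi / 2 * Complex.I := by ring
  rw [wtA, hx₀, Complex.sinh_mul_I, Complex.sin_pi_div_two, one_mul]
  exact Complex.I_ne_zero

lemma continuous_wtA (γ : ℂ) : Continuous (wtA γ) := by
  unfold wtA; fun_prop

lemma continuous_wtB : Continuous wtB :=
  Complex.continuous_sinh

lemma continuous_Rmat (γ : ℂ) (p q : Fin 2 × Fin 2) : Continuous fun x => Rmat γ x p q := by
  unfold Rmat
  split_ifs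
  exacts [continuous_wtA γ, continuous_wtB, continuous_const, continuous_const]

lemma continuous_block (γ : ℂ) {L : ℕ} (a b : Fin 2) :
    Continuous fun p : (Fin L → ℂ) × ℂ => block γ p.1 p.2 a b := by
  have hmonodromy : Continuous fun p : (Fin L → ℂ) × ℂ => monodromy γ p.1 p.2 := by
    simp only [monodromy, List.ofFn_eq_map]
    refine continuous_list_prod _ fun j _ => continuous_matrix fun s t => ?_
    unfold RmatAt
    split_ifs
    · exact (continuous_Rmat γ _ _).comp (by fun_prop)
    · exact continuous_const
  exact continuous_matrix fun s t => hmonodromy.matrix_elem _ _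

theorem block_commute (γ : ℂ) {L : ℕ} (μ : Fin L → ℂ) (x y : ℂ) (a b : Fin 2) :
    Commute (block γ μ x a b) (block γ μ y a b) := by
  have hcont : Continuous fun x => block γ μ x a b :=
    (continuous_block γ a b).comp (f := fun x => (μ, x)) (Continuous.prodMk_right μ)
  refine congrFun (Continuous.ext_on (dense_wtA_sub_ne_zero γ y) (hcont.mul continuous_const)
    (continuous_const.mul hcont) fun x hx => ?_) x
  have h := block_yangBaxter γ μ x y a a b b
  fin_cases a <;> fin_cases b <;> simpa [Rmat, (show wtA γ (x - y) ≠ 0 from hx)] using h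

/-- The product `T_{ab}(X₁) ⋯ T_{ab}(X_n)` of blocks of the monodromy matrix. -/
def prodBlock (γ : ℂ) {L n : ℕ} (μ : Fin L → ℂ) (a b : Fin 2) (X : Fin n → ℂ) : Op L :=
  (List.ofFn fun i => block γ μ (X i) a b).prod

lemma prodBlock_succ (γ : ℂ) {L n : ℕ} (μ : Fin L → ℂ) (a b : Fin 2) (X : Fin (n + 1) → ℂ) :
    prodBlock γ μ a b X = block γ μ (X 0) a b * prodBlock γ μ a b fun k => X k.succ := by
  simp [prodBlock, List.ofFn_succ]

lemma prodBlock_cons (γ : ℂ) {L n : ℕ} (μ : Fin L → ℂ) (a b : Fin 2) (x : ℂ) (X : Fin n → ℂ) :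
    prodBlock γ μ a b (Fin.cons x X : Fin (n + 1) → ℂ) =
      block γ μ x a b * prodBlock γ μ a b X := by
  simp [prodBlock_succ]

lemma block_commute_prodBlock (γ : ℂ) {L n : ℕ} (μ : Fin L → ℂ) (a b : Fin 2) (x : ℂ)
    (X : Fin n → ℂ) : Commute (block γ μ x a b) (prodBlock γ μ a b X) := by
  refine Commute.list_prod_right _ _ fun M hM => ?_
  obtain ⟨i, rfl⟩ := (List.mem_ofFn' _ _).1 hM
  exact block_commute γ μ _ _ a b

lemma scalarProduct_eq (γ : ℂ) {L n : ℕ} (μ : Fin L → ℂ) (X Y : Fin n → ℂ) :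
    scalarProduct γ μ X Y = (prodBlock γ μ 1 0 X * prodBlock γ μ 0 1 Y) (vac L) (vac L) := rfl

section vacuum
variable (γ : ℂ) {L : ℕ} (μ : Fin L → ℂ) (x : ℂ)

lemma eq_vac_succ_iff (s : Fin (L + 1) → Fin 2) :
    s = vac (L + 1) ↔ s 0 = 0 ∧ Fin.tail s = vac L := by
  simp only [funext_iff, Fin.forall_fin_succ]
  rfl

lemma block_apply_vac (s : Fin L → Fin 2) :
    block γ μ x 0 0 s (vac L) = (∏ k, wtA γ (x - μ k)) * (Pi.single (vac L) 1 : _ → ℂ) s ∧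
    block γ μ x 1 1 s (vac L) = (∏ k, wtB (x - μ k)) * (Pi.single (vac L) 1 : _ → ℂ) s ∧
    block γ μ x 1 0 s (vac L) = 0 := by
  induction L with
  | zero => simp [block_zero, Subsingleton.elim s (vac 0)]
  | succ L ih =>
    obtain ⟨hA, hD, hC⟩ := ih (fun k => μ k.succ) (Fin.tail s)
    have htail : Fin.tail (vac (L + 1)) = vac L := rfl
    have hhead : vac (L + 1) 0 = 0 := rfl
    simp only [block_succ γ μ, Fin.sum_univ_two, Matrix.add_apply, tens_apply, htail, hhead,
      hA, hD, hC, Fin.prod_univ_succ]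
    rcases Fin.exists_fin_two.1 ⟨s 0, rfl⟩ with h | h <;> by_cases h' : Fin.tail s = vac L <;>
      simp [site, Rmat, Pi.single_apply, eq_vac_succ_iff, h, h']

lemma block_vac_apply (s : Fin L → Fin 2) :
    block γ μ x 0 0 (vac L) s = (∏ k, wtA γ (x - μ k)) * (Pi.single (vac L) 1 : _ → ℂ) s ∧
    block γ μ x 1 1 (vac L) s = (∏ k, wtB (x - μ k)) * (Pi.single (vac L) 1 : _ → ℂ) s ∧
    block γ μ x 0 1 (vac L) s = 0 := by
  induction L with
  | zero => simp [block_zero, Subsingleton.elim s (vac 0)]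
  | succ L ih =>
    obtain ⟨hA, hD, hB⟩ := ih (fun k => μ k.succ) (Fin.tail s)
    have htail : Fin.tail (vac (L + 1)) = vac L := rfl
    have hhead : vac (L + 1) 0 = 0 := rfl
    simp only [block_succ γ μ, Fin.sum_univ_two, Matrix.add_apply, tens_apply, htail, hhead,
      hA, hD, hB, Fin.prod_univ_succ]
    rcases Fin.exists_fin_two.1 ⟨s 0, rfl⟩ with h | h <;> by_cases h' : Fin.tail s = vac L <;>
      simp [site, Rmat, Pi.single_apply, eq_vac_succ_iff, h, h']

end vacuum

section weights
variable {γ : ℂ}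

lemma wtA_zero : wtA γ 0 = wtC γ := congrArg Complex.sinh (zero_add γ)

lemma wtB_zero : wtB 0 = 0 := Complex.sinh_zero

lemma wtA_neg_self : wtA γ (-γ) = 0 := by simp [wtA]

lemma wtB_neg (x : ℂ) : wtB (-x) = -wtB x := Complex.sinh_neg x

lemma wtB_neg_self : wtB (-γ) = -wtC γ := wtB_neg γ

lemma wtB_sub_sub_self (x y : ℂ) : wtB (x - y - γ) = -wtA γ (y - x) := by
  rw [wtA, wtB, ← Complex.sinh_neg]; congr 1; ring

lemma prod_wtB_sub_sub_self {ι : Type*} [Fintype ι] (x : ℂ) (y : ι → ℂ) :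
    ∏ k, wtB (x - y k - γ) = (-1) ^ Fintype.card ι * ∏ k, wtA γ (y k - x) := by
  simp only [wtB_sub_sub_self, Finset.prod_neg, Finset.card_univ]

end weights

section firstSite
variable {γ : ℂ} {L : ℕ} {μ : Fin (L + 1) → ℂ} {a b : Fin 2}

lemma site_self (hab : a ≠ b) (x : ℂ) :
    site γ x a a = wtA γ x • Matrix.single a a 1 + wtB x • Matrix.single b b 1 := by
  ext s t
  fin_cases a <;> fin_cases b <;> fin_cases s <;> fin_cases t <;> simp_all [site, Rmat]

lemma site_of_ne (hab : a ≠ b) (x : ℂ) : site γ x a b = wtC γ • Matrix.single b a 1 := by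
  ext s t
  fin_cases a <;> fin_cases b <;> fin_cases s <;> fin_cases t <;> simp_all [site, Rmat]

lemma block_succ_of_ne (hab : a ≠ b) (x : ℂ) :
    block γ μ x a b =
      wtA γ (x - μ 0) • tens (Matrix.single a a 1) (block γ (fun k => μ k.succ) x a b) +
        wtB (x - μ 0) • tens (Matrix.single b b 1) (block γ (fun k => μ k.succ) x a b) +
        wtC γ • tens (Matrix.single b a 1) (block γ (fun k => μ k.succ) x b b) := by
  rw [block_succ, Fintype.sum_eq_add a b hab (by omega), site_self hab, site_of_ne hab]
  simp only [map_add, map_smul, LinearMap.add_apply, LinearMap.smul_apply]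

lemma block_mul_tens (hab : a ≠ b) (x : ℂ) (Y : Op L) (t : Fin 2) :
    block γ μ x a b * tens (Matrix.single b t 1) Y =
      wtB (x - μ 0) • tens (Matrix.single b t 1) (block γ (fun k => μ k.succ) x a b * Y) := by
  simp [block_succ_of_ne hab, add_mul, tens_mul_tens, hab]

lemma tens_mul_block (hab : a ≠ b) (x : ℂ) (Y : Op L) (s : Fin 2) :
    tens (Matrix.single s a 1) Y * block γ μ x a b =
      wtA γ (x - μ 0) • tens (Matrix.single s a 1) (Y * block γ (fun k => μ k.succ) x a b) := by
  simp [block_succ_of_ne hab, mul_add, tens_mul_tens, hab]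

lemma prodBlock_mul_tens (hab : a ≠ b) {n : ℕ} (X : Fin n → ℂ) (Y : Op L) (t : Fin 2) :
    prodBlock γ μ a b X * tens (Matrix.single b t 1) Y = (∏ i, wtB (X i - μ 0)) •
      tens (Matrix.single b t 1) (prodBlock γ (fun k => μ k.succ) a b X * Y) := by
  induction n with
  | zero => simp [prodBlock]
  | succ n ih =>
    rw [prodBlock_succ, mul_assoc, ih, mul_smul_comm, block_mul_tens hab, smul_smul, mul_comm,
      ← Fin.prod_univ_succ fun i => wtB (X i - μ 0), ← mul_assoc, ← prodBlock_succ]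

lemma tens_mul_prodBlock (hab : a ≠ b) {n : ℕ} (X : Fin n → ℂ) (Y : Op L) (s : Fin 2) :
    tens (Matrix.single s a 1) Y * prodBlock γ μ a b X = (∏ i, wtA γ (X i - μ 0)) •
      tens (Matrix.single s a 1) (Y * prodBlock γ (fun k => μ k.succ) a b X) := by
  induction n generalizing Y with
  | zero => simp [prodBlock]
  | succ n ih =>
    rw [prodBlock_succ, ← mul_assoc, tens_mul_block hab, smul_mul_assoc, ih, smul_smul,
      ← Fin.prod_univ_succ fun i => wtA γ (X i - μ 0), mul_assoc, ← prodBlock_succ]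

lemma block_shift_mul_block (hab : a ≠ b) :
    block γ μ (μ 0 - γ) a b * block γ μ (μ 0) a b = 0 := by
  have hdet : block γ (fun k => μ k.succ) (μ 0 - γ) a b * block γ (fun k => μ k.succ) (μ 0) b b =
      block γ (fun k => μ k.succ) (μ 0 - γ) b b * block γ (fun k => μ k.succ) (μ 0) a b := by
    have h := block_quantumDet γ (fun k => μ k.succ) (μ 0) b b
    fin_cases a <;> fin_cases b <;> simp_all [antisymm, sub_eq_zero]
  simp [block_succ_of_ne hab, hab, add_mul, mul_add, tens_mul_tens, wtA_zero, wtB_zero,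
    wtA_neg_self, wtB_neg_self, hdet, hab.symm]

lemma opC_shift_mul_opB :
    block γ μ (μ 0 - γ) 1 0 * block γ μ (μ 0) 0 1 =
      recConst γ μ • tens (Matrix.single 0 0 1) (1 : Op L) := by
  set T := block γ (fun k => μ k.succ)
  have hconst : recConst γ μ =
      wtC γ ^ 2 * ∏ k : Fin L, wtA γ (μ 0 - μ k.succ) * wtB (μ 0 - μ k.succ - γ) := by
    rw [recConst, Finset.prod_mul_distrib, Finset.prod_mul_distrib, prod_wtB_sub_sub_self,
      Fintype.card_fin]
    ring
  have hdet := block_quantumDet γ (fun k => μ k.succ) (μ 0) 0 1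
  calc block γ μ (μ 0 - γ) 1 0 * block γ μ (μ 0) 0 1
    _ = wtC γ ^ 2 • tens (Matrix.single 0 0 1)
          (T (μ 0 - γ) 0 0 * T (μ 0) 1 1 - T (μ 0 - γ) 1 0 * T (μ 0) 0 1) := by
        simp [block_succ_of_ne, add_mul, mul_add, tens_mul_tens, wtA_zero, wtB_zero, wtA_neg_self,
          wtB_neg_self, T]
        module
    _ = _ := by
        rw [hdet, hconst, map_smul, smul_smul]
        simp only [antisymm, Matrix.of_apply, Matrix.cons_val_zero, Matrix.cons_val_one, one_mul,
          Matrix.cons_val_fin_one]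

lemma tens_single_vac (Y : Op L) :
    tens (Matrix.single 0 0 1) Y (vac (L + 1)) (vac (L + 1)) = Y (vac L) (vac L) := by
  rw [tens_apply, show vac (L + 1) 0 = 0 from rfl, Matrix.single_apply_same, one_mul]
  rfl

theorem scalarProduct_special_left {n : ℕ} (X Y : Fin n → ℂ) :
    scalarProduct γ μ (Fin.cons (μ 0 - γ) X : Fin (n + 1) → ℂ)
        (Fin.cons (μ 0) Y : Fin (n + 1) → ℂ) =
      (∏ j, wtB (X j - μ 0) * wtA γ (Y j - μ 0)) * Vfun γ μ X Y := by
  rw [scalarProduct_eq, prodBlock_cons, prodBlock_cons, (block_commute_prodBlock ..).eq,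
    ← mul_assoc, mul_assoc (prodBlock γ μ 1 0 X), opC_shift_mul_opB, mul_smul_comm,
    prodBlock_mul_tens one_ne_zero, smul_mul_assoc, smul_mul_assoc, tens_mul_prodBlock zero_ne_one]
  simp only [Matrix.smul_apply, smul_eq_mul, tens_single_vac, mul_one, ← scalarProduct_eq, Vfun,
    Finset.prod_mul_distrib]
  ring

lemma tens_single_mul_mul_tens_single_vac (M : Op (L + 1)) :
    (tens (Matrix.single 0 0 1) 1 * M * tens (Matrix.single 0 0 1) 1 : Op (L + 1))
        (vac (L + 1)) (vac (L + 1)) = M (vac (L + 1)) (vac (L + 1)) := by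
  have hproj : tens (Matrix.single 0 0 1) (1 : Op L) =
      Matrix.diagonal fun s => if s 0 = 0 then 1 else 0 := by
    ext s t
    by_cases hst : s = t
    · subst hst
      simp [Matrix.single_apply, eq_comm]
    · have : ¬(s 0 = t 0 ∧ Fin.tail s = Fin.tail t) := fun h =>
        hst (by rw [← Fin.cons_self_tail s, h.1, h.2, Fin.cons_self_tail])
      simp [Matrix.single_apply, Matrix.one_apply, hst]
      grind
  simp [hproj, Matrix.mul_diagonal, Matrix.diagonal_mul, vac]

lemma opA_mul_mul_opD_vac (ν : Fin L → ℂ) (x y : ℂ) (M : Op L) :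
    (block γ ν x 0 0 * M * block γ ν y 1 1) (vac L) (vac L) =
      (∏ k, wtA γ (x - ν k)) * (∏ k, wtB (y - ν k)) * M (vac L) (vac L) := by
  simp only [Matrix.mul_apply, (block_apply_vac γ ν y _).2.1, (block_vac_apply γ ν x _).1]
  simp only [Pi.single_apply, mul_ite, mul_one, mul_zero, ite_mul, zero_mul, Finset.sum_ite_eq',
    Finset.mem_univ, if_true]
  ring

theorem scalarProduct_special_right {n : ℕ} (X Y : Fin n → ℂ) :
    scalarProduct γ μ (Fin.cons (μ 0) X : Fin (n + 1) → ℂ)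
        (Fin.cons (μ 0 - γ) Y : Fin (n + 1) → ℂ) =
      (∏ j, wtA γ (X j - μ 0) * wtB (Y j - μ 0)) * Vfun γ μ X Y := by
  set T := block γ (fun k => μ k.succ)
  set E : Op (L + 1) := tens (Matrix.single 0 0 1) 1
  have hC : E * block γ μ (μ 0) 1 0 = wtC γ • tens (Matrix.single 0 1 1) (T (μ 0) 0 0) := by
    simp [E, T, block_succ_of_ne, mul_add, tens_mul_tens, wtB_zero, -Matrix.smul_single]
  have hB : block γ μ (μ 0 - γ) 0 1 * E =
      wtC γ • tens (Matrix.single 1 0 1) (T (μ 0 - γ) 1 1) := by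
    simp [E, T, block_succ_of_ne, add_mul, tens_mul_tens, wtA_neg_self, -Matrix.smul_single]
  have hassoc : E * (block γ μ (μ 0) 1 0 * prodBlock γ μ 1 0 X *
        (prodBlock γ μ 0 1 Y * block γ μ (μ 0 - γ) 0 1)) * E =
      (E * block γ μ (μ 0) 1 0 * prodBlock γ μ 1 0 X) *
        (prodBlock γ μ 0 1 Y * (block γ μ (μ 0 - γ) 0 1 * E)) := by
    simp only [mul_assoc]
  rw [scalarProduct_eq, prodBlock_cons, prodBlock_cons, (block_commute_prodBlock γ μ 0 1 _ Y).eq]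
  refine (tens_single_mul_mul_tens_single_vac _).symm.trans ?_
  rw [hassoc, hC, hB, smul_mul_assoc, mul_smul_comm,
    tens_mul_prodBlock one_ne_zero, prodBlock_mul_tens zero_ne_one]
  simp only [smul_mul_assoc, mul_smul_comm, tens_mul_tens, Matrix.single_mul_single_same, mul_one,
    Matrix.smul_apply, tens_single_vac]
  rw [← mul_assoc, mul_assoc (T (μ 0) 0 0), opA_mul_mul_opD_vac, ← scalarProduct_eq, Vfun,
    recConst, Finset.prod_mul_distrib, Finset.prod_mul_distrib]
  simp only [sub_right_comm (μ 0) γ, prod_wtB_sub_sub_self, smul_eq_mul, Fintype.card_fin]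
  ring

end firstSite

section eraseProducts
variable {M : Type*} [CommMonoid M] {n : ℕ}

lemma prod_erase_eq_prod_succAbove (i : Fin (n + 1)) (f : Fin (n + 1) → M) :
    ∏ k ∈ Finset.univ.erase i, f k = ∏ k, f (i.succAbove k) := by
  have huniv : Finset.univ.erase i = Finset.univ.map (Fin.succAboveEmb i) := by
    ext k
    simp [Fin.exists_succAbove_eq_iff (x := i) (y := k)]
  rw [huniv, Finset.prod_map]
  rfl

lemma prod_erase_zero (f : Fin (n + 1) → M) :
    ∏ k ∈ Finset.univ.erase 0, f k = ∏ k : Fin n, f k.succ := by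
  simp only [prod_erase_eq_prod_succAbove, Fin.succAbove_zero]

lemma prod_erase_succ (i : Fin n) (f : Fin (n + 1) → M) :
    ∏ k ∈ Finset.univ.erase i.succ, f k = f 0 * ∏ k ∈ Finset.univ.erase i, f k.succ := by
  obtain _ | n := n
  · exact i.elim0
  · simp [prod_erase_eq_prod_succAbove, Fin.prod_univ_succ fun k => f (i.succ.succAbove k)]

end eraseProducts

/-! ### The algebraic Bethe ansatz -/

open scoped Matrix

lemma wtA_mul_wtB_add (γ p q : ℂ) :
    wtA γ p * wtB q + wtA γ (-q) * wtB p = wtC γ * wtB (p + q) := by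
  simp only [wtA, wtB, wtC, Complex.sinh_add, Complex.sinh_neg, Complex.cosh_neg]
  ring

lemma exchange_coefficient {γ p q : ℂ} (hp : wtB p ≠ 0) (hq : wtB q ≠ 0)
    (hpq : wtB (p + q) ≠ 0) :
    wtA γ p / wtB p * (wtC γ / wtB (p + q)) - wtC γ / wtB p * (wtC γ / wtB q) =
      wtC γ / wtB (p + q) * (wtA γ (-q) / wtB (-q)) := by
  rw [wtB_neg]
  field_simp
  linear_combination wtC γ * wtA_mul_wtB_add γ p q

/-- The off-shell Bethe vector `X(y₁) ⋯ X(y_n) v`. -/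
def bethe {N : Type*} [Fintype N] [DecidableEq N] (X : ℂ → Matrix N N ℂ) (v : N → ℂ)
    {n : ℕ} (y : Fin n → ℂ) : N → ℂ :=
  (List.ofFn fun i => X (y i)).prod *ᵥ v

/-- The input of the algebraic Bethe ansatz: a commuting family `X` of creation operators, and a
family `Z` for which `v` is an eigenvector, with eigenvalues `e`, and which satisfies an exchange
relation with `X`. The parameter `ε` is `1` for the operator `A` and `-1` for `D`, whose relations
differ only by the sign of the arguments of the weights. -/
structure Exchange {N : Type*} [Fintype N] (γ ε : ℂ) (X Z : ℂ → Matrix N N ℂ) (v : N → ℂ)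
    (e : ℂ → ℂ) : Prop where
  commute : ∀ x y, Commute (X x) (X y)
  vacuum : ∀ x, Z x *ᵥ v = e x • v
  relation : ∀ x y, wtB (ε * (y - x)) • (Z x * X y) =
    wtA γ (ε * (y - x)) • (X y * Z x) - wtC γ • (X x * Z y)

section ansatz
variable {N : Type*} [Fintype N] {X Z : ℂ → Matrix N N ℂ} {v : N → ℂ} {e : ℂ → ℂ} {γ ε : ℂ}

lemma Exchange.mul_eq (E : Exchange γ ε X Z v e) {x y : ℂ} (h : wtB (ε * (y - x)) ≠ 0) :
    Z x * X y = (wtA γ (ε * (y - x)) / wtB (ε * (y - x))) • (X y * Z x)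
      - (wtC γ / wtB (ε * (y - x))) • (X x * Z y) := by
  rw [← inv_smul_smul₀ h (Z x * X y), E.relation, smul_sub, smul_smul, smul_smul, div_eq_inv_mul,
    div_eq_inv_mul]

variable [DecidableEq N]

lemma bethe_cons {n : ℕ} (x : ℂ) (y : Fin n → ℂ) :
    bethe X v (Fin.cons x y : Fin (n + 1) → ℂ) = X x *ᵥ bethe X v y := by
  simp [bethe, List.ofFn_succ]

lemma bethe_comp_perm (hX : ∀ x y, Commute (X x) (X y)) {n : ℕ} (y : Fin n → ℂ)
    (σ : Equiv.Perm (Fin n)) : bethe X v (y ∘ σ) = bethe X v y := by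
  unfold bethe
  congr 1
  refine List.Perm.prod_eq' (Equiv.Perm.ofFn_comp_perm σ fun i => X (y i)) ?_
  rw [List.pairwise_ofFn]
  exact fun i j _ => hX _ _

lemma bethe_update (hX : ∀ x y, Commute (X x) (X y)) {n : ℕ} (y : Fin (n + 1) → ℂ)
    (i : Fin (n + 1)) (x : ℂ) :
    bethe X v (Function.update y i x) =
      bethe X v (Fin.cons x fun k => y (i.succAbove k) : Fin (n + 1) → ℂ) := by
  rw [← bethe_comp_perm hX _ i.cycleRange.symm]
  congr 1
  funext k
  refine Fin.cases ?_ (fun k => ?_) k <;> simp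

lemma mulVec_bethe_update_comm (hX : ∀ x y, Commute (X x) (X y)) {n : ℕ} (y : Fin n → ℂ)
    (i : Fin n) (x z : ℂ) :
    X x *ᵥ bethe X v (Function.update y i z) = X z *ᵥ bethe X v (Function.update y i x) := by
  obtain _ | n := n
  · exact i.elim0
  · rw [bethe_update hX, bethe_update hX, bethe_cons, bethe_cons, Matrix.mulVec_mulVec,
      Matrix.mulVec_mulVec, (hX x z).eq]

lemma bethe_cons_cons_eq_zero {x z : ℂ} (h : X x * X z = 0) {n : ℕ} (y : Fin (n + 1) → ℂ)
    (hy : y 0 = z) : bethe X v (Fin.cons x y : Fin (n + 2) → ℂ) = 0 := by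
  rw [bethe_cons, ← Fin.cons_self_tail y, bethe_cons, Matrix.mulVec_mulVec, hy, h,
    Matrix.zero_mulVec]

namespace Exchange

theorem mulVec_bethe (E : Exchange γ ε X Z v e) {n : ℕ} (y : Fin n → ℂ)
    (hy : ∀ i k, i ≠ k → wtB (ε * (y i - y k)) ≠ 0) (x : ℂ)
    (hx : ∀ i, wtB (ε * (y i - x)) ≠ 0) :
    Z x *ᵥ bethe X v y =
      (e x * ∏ k, wtA γ (ε * (y k - x)) / wtB (ε * (y k - x))) • bethe X v y
      - ∑ i, (wtC γ / wtB (ε * (y i - x)) * e (y i) * ∏ k ∈ Finset.univ.erase i,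
          wtA γ (ε * (y k - y i)) / wtB (ε * (y k - y i))) • bethe X v (Function.update y i x) := by
  induction n generalizing x with
  | zero => simp [bethe, E.vacuum]
  | succ n ih =>
    induction y using Fin.consCases with | _ y₀ y
    have hx₀ : wtB (ε * (y₀ - x)) ≠ 0 := hx 0
    have hx' : ∀ i, wtB (ε * (y i - x)) ≠ 0 := fun i => hx i.succ
    have hy₀ : ∀ i, wtB (ε * (y i - y₀)) ≠ 0 := fun i => hy i.succ 0 i.succ_ne_zero
    have hy' : ∀ i k, i ≠ k → wtB (ε * (y i - y k)) ≠ 0 := fun i k hik =>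
      hy i.succ k.succ (Fin.succ_injective n |>.ne hik)
    have hcoeff : ∀ i, wtA γ (ε * (y₀ - x)) / wtB (ε * (y₀ - x)) * (wtC γ / wtB (ε * (y i - x)))
          - wtC γ / wtB (ε * (y₀ - x)) * (wtC γ / wtB (ε * (y i - y₀))) =
        wtC γ / wtB (ε * (y i - x)) *
          (wtA γ (ε * (y₀ - y i)) / wtB (ε * (y₀ - y i))) := fun i => by
      have hadd : ε * (y i - x) = ε * (y₀ - x) + ε * (y i - y₀) := by ring
      have hneg : ε * (y₀ - y i) = -(ε * (y i - y₀)) := by ring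
      rw [hneg, hadd]
      exact exchange_coefficient hx₀ (hy₀ i) (hadd ▸ hx' i)
    rw [bethe_cons, Matrix.mulVec_mulVec, E.mul_eq hx₀, Matrix.sub_mulVec, Matrix.smul_mulVec,
      Matrix.smul_mulVec, ← Matrix.mulVec_mulVec, ← Matrix.mulVec_mulVec, ih y hy' x hx',
      ih y hy' y₀ hy₀, Fin.sum_univ_succ, Fin.prod_univ_succ]
    simp only [Fin.update_cons_zero, ← Fin.cons_update, bethe_cons, Fin.cons_zero, Fin.cons_succ,
      prod_erase_succ, prod_erase_zero, Matrix.mulVec_sub, Matrix.mulVec_smul, Matrix.mulVec_sum,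
      mulVec_bethe_update_comm E.commute y _ x y₀, ← mul_assoc]
    simp only [mul_right_comm _ (e _), ← hcoeff]
    simp only [sub_mul, sub_smul, Finset.sum_sub_distrib, mul_assoc, ← smul_smul, ← Finset.smul_sum,
      smul_sub]
    module

theorem mulVec_bethe_cons (E : Exchange γ ε X Z v e) {n : ℕ} (y : Fin (n + 1) → ℂ)
    (hy : ∀ i k, i ≠ k → wtB (ε * (y i - y k)) ≠ 0) (x : ℂ)
    (hx : ∀ i, wtB (ε * (y i - x)) ≠ 0) :
    Z x *ᵥ bethe X v y =
      (e x * ∏ k, wtA γ (ε * (y k - x)) / wtB (ε * (y k - x))) • bethe X v y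
      - ∑ i, (wtC γ / wtB (ε * (y i - x)) * e (y i) * ∏ k ∈ Finset.univ.erase i,
          wtA γ (ε * (y k - y i)) / wtB (ε * (y k - y i))) •
          bethe X v (Fin.cons x fun k => y (i.succAbove k) : Fin (n + 1) → ℂ) := by
  simpa only [bethe_update E.commute] using E.mulVec_bethe y hy x hx

lemma mulVec_bethe_shift (E : Exchange γ (-1) X Z v e) (hc : wtC γ ≠ 0) {z : ℂ} (hz : e z = 0)
    (hX : X (z - γ) * X z = 0) {n : ℕ} (y : Fin n → ℂ) (hy : ∀ i k, i ≠ k → wtB (y i - y k) ≠ 0)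
    (hyz : ∀ i, wtA γ (y i - z) ≠ 0 ∧ wtB (y i - z) ≠ 0) :
    Z (z - γ) *ᵥ bethe X v (Fin.cons z y : Fin (n + 1) → ℂ) = 0 := by
  rw [E.mulVec_bethe_cons]
  · rw [Finset.prod_eq_zero (Finset.mem_univ 0) (by simp [wtA_neg_self]), mul_zero, zero_smul,
      zero_sub, neg_eq_zero, Fin.sum_univ_succ, Fin.cons_zero, hz, mul_zero, zero_mul, zero_smul,
      zero_add]
    refine Finset.sum_eq_zero fun i _ => ?_
    obtain _ | n := n
    · exact i.elim0
    · rw [bethe_cons_cons_eq_zero hX _ (by simp), smul_zero]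
  · refine Fin.cases (Fin.cases (absurd rfl) fun k _ => ?_) fun i => Fin.cases (fun _ => ?_) ?_
    · simpa using (hyz k).2
    · simpa only [Fin.cons_succ, Fin.cons_zero, neg_one_mul, wtB_neg, neg_ne_zero] using (hyz i).2
    · simpa only [Fin.cons_succ, neg_one_mul, wtB_neg, neg_ne_zero, ne_eq, Fin.succ_inj] using hy i
  · refine Fin.cases ?_ fun i => ?_
    · simpa [wtB_neg_self] using hc
    · rw [Fin.cons_succ, neg_one_mul, neg_sub, sub_right_comm, wtB_sub_sub_self]
      exact neg_ne_zero.2 (hyz i).1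

end Exchange

end ansatz

section recursion
variable {γ : ℂ}

lemma transpose_mulVec_dotProduct {N : Type*} [Fintype N] (Z : Matrix N N ℂ) (u w : N → ℂ) :
    Zᵀ *ᵥ u ⬝ᵥ w = u ⬝ᵥ Z *ᵥ w := by
  rw [Matrix.mulVec_transpose, Matrix.dotProduct_mulVec]

/-- The Bethe vector `B(y₁) ⋯ B(y_n) |0⟩`. -/
abbrev rightBethe (γ : ℂ) {L n : ℕ} (μ : Fin L → ℂ) (y : Fin n → ℂ) : (Fin L → Fin 2) → ℂ :=
  bethe (fun x => block γ μ x 0 1) (Pi.single (vac L) 1) y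

/-- The Bethe vector `⟨0| C(y₁) ⋯ C(y_n)`, as a column vector. -/
abbrev leftBethe (γ : ℂ) {L n : ℕ} (μ : Fin L → ℂ) (y : Fin n → ℂ) : (Fin L → Fin 2) → ℂ :=
  bethe (fun x => (block γ μ x 1 0)ᵀ) (Pi.single (vac L) 1) y

section exchange
variable {L : ℕ} (μ : Fin L → ℂ)

lemma transpose_block_commute (x y : ℂ) (a b : Fin 2) :
    Commute (block γ μ x a b)ᵀ (block γ μ y a b)ᵀ := by
  rw [Commute, SemiconjBy, ← Matrix.transpose_mul, ← Matrix.transpose_mul,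
    (block_commute γ μ x y a b).eq]

lemma exchange_opB_opA :
    Exchange γ 1 (fun x => block γ μ x 0 1) (fun x => block γ μ x 0 0) (Pi.single (vac L) 1)
      fun x => ∏ k, wtA γ (x - μ k) where
  commute x y := block_commute γ μ x y 0 1
  vacuum x := by
    ext s
    simpa using (block_apply_vac γ μ x s).1
  relation x y := by
    have h := block_yangBaxter γ μ y x 0 0 1 0
    simpa [Rmat, eq_sub_iff_add_eq'] using h.symm

lemma exchange_opB_opD :
    Exchange γ (-1) (fun x => block γ μ x 0 1) (fun x => block γ μ x 1 1) (Pi.single (vac L) 1)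
      fun x => ∏ k, wtB (x - μ k) where
  commute x y := block_commute γ μ x y 0 1
  vacuum x := by
    ext s
    simpa using (block_apply_vac γ μ x s).2.1
  relation x y := by
    have h := block_yangBaxter γ μ x y 1 0 1 1
    simpa [Rmat, eq_sub_iff_add_eq'] using h

lemma exchange_transpose_opC_opA :
    Exchange γ 1 (fun x => (block γ μ x 1 0)ᵀ) (fun x => (block γ μ x 0 0)ᵀ)
      (Pi.single (vac L) 1) fun x => ∏ k, wtA γ (x - μ k) where
  commute x y := transpose_block_commute μ x y 1 0
  vacuum x := by
    ext s
    simpa using (block_vac_apply γ μ x s).1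
  relation x y := by
    have h := congrArg Matrix.transpose (block_yangBaxter γ μ y x 1 0 0 0)
    simpa [Rmat, eq_sub_iff_add_eq'] using h

lemma exchange_transpose_opC_opD :
    Exchange γ (-1) (fun x => (block γ μ x 1 0)ᵀ) (fun x => (block γ μ x 1 1)ᵀ)
      (Pi.single (vac L) 1) fun x => ∏ k, wtB (x - μ k) where
  commute x y := transpose_block_commute μ x y 1 0
  vacuum x := by
    ext s
    simpa using (block_vac_apply γ μ x s).2.1
  relation x y := by
    have h := congrArg Matrix.transpose (block_yangBaxter γ μ x y 1 1 1 0)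
    simpa [Rmat, eq_sub_iff_add_eq'] using h.symm

lemma scalarProduct_eq_dotProduct {n : ℕ} (X Y : Fin n → ℂ) :
    scalarProduct γ μ X Y = leftBethe γ μ X ⬝ᵥ rightBethe γ μ Y := by
  have htranspose : (List.ofFn fun i => (block γ μ (X i) 1 0)ᵀ).prod = (prodBlock γ μ 1 0 X)ᵀ := by
    rw [prodBlock, Matrix.transpose_list_prod, List.map_ofFn]
    refine List.Perm.prod_eq' (List.reverse_perm _).symm ?_
    rw [List.pairwise_ofFn]
    exact fun i j _ => transpose_block_commute μ _ _ 1 0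
  rw [scalarProduct_eq, Matrix.mul_apply, leftBethe, rightBethe]
  unfold bethe
  rw [htranspose]
  simp [dotProduct, prodBlock]

lemma opB_eq_zero (hc : wtC γ = 0) (x : ℂ) : block γ μ x 0 1 = 0 := by
  induction L with
  | zero => simp [block_zero]
  | succ L ih => simp [block_succ_of_ne, ih, hc]

lemma scalarProduct_eq_zero (hc : wtC γ = 0) {n : ℕ} (X Y : Fin (n + 1) → ℂ) :
    scalarProduct γ μ X Y = 0 := by
  rw [scalarProduct_eq, prodBlock_succ γ μ 0 1, opB_eq_zero μ hc, zero_mul, mul_zero,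
    Matrix.zero_apply]

end exchange

variable {L : ℕ} {μ : Fin (L + 1) → ℂ}

lemma wtA_sub_sub_of_shift (x y : ℂ) : wtA γ (x - γ - y) = -wtB (y - x) := by
  rw [wtA, wtB, ← Complex.sinh_neg]; congr 1; ring

lemma wtB_sub_sub_of_shift (x y : ℂ) : wtB (x - γ - y) = -wtA γ (y - x) := by
  rw [sub_right_comm, wtB_sub_sub_self]

lemma prod_wtB_sub_comm {ι : Type*} [Fintype ι] (x : ℂ) (y : ι → ℂ) :
    ∏ k, wtB (x - y k) = (-1) ^ Fintype.card ι * ∏ k, wtB (y k - x) := by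
  rw [← Finset.card_univ, ← Finset.prod_neg]
  exact Finset.prod_congr rfl fun k _ => by rw [← wtB_neg, neg_sub]

lemma prod_wtB_shift_sub : ∏ k, wtB (μ 0 - γ - μ k) =
    (-1) ^ (L + 1) * (wtC γ * ∏ k : Fin L, wtA γ (μ k.succ - μ 0)) := by
  simp only [sub_right_comm (μ 0) γ]
  rw [prod_wtB_sub_sub_self, Fin.prod_univ_succ, sub_self, wtA_zero, Fintype.card_fin]

lemma prod_succAbove_eq_div {n : ℕ} (i : Fin (n + 1)) {f : Fin (n + 1) → ℂ} (h : f i ≠ 0) :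
    ∏ k, f (i.succAbove k) = (∏ k, f k) / f i := by
  rw [Fin.prod_univ_succAbove f i, mul_div_cancel_left₀ _ h]

/-- The vector `w` is orthogonal to the image of `Z(μ₁ - γ)`, so that the expansion of
`Z(μ₁ - γ) X(y₁) ⋯ X(y_n) v` determines `X(y₁) ⋯ X(y_n) v ⬝ w`. -/
lemma Exchange.dotProduct_bethe {N : Type*} [Fintype N] [DecidableEq N] {X Z : ℂ → Matrix N N ℂ}
    {v w : N → ℂ} (E : Exchange γ (-1) X Z v fun x => ∏ k, wtB (x - μ k)) (hc : wtC γ ≠ 0)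
    (hw : (Z (μ 0 - γ))ᵀ *ᵥ w = 0) {n : ℕ} (y : Fin (n + 1) → ℂ)
    (hy : ∀ i k, i ≠ k → wtB (y i - y k) ≠ 0)
    (hy₀ : ∀ i, wtA γ (y i - μ 0) ≠ 0 ∧ wtB (y i - μ 0) ≠ 0) {t : Fin (n + 1) → ℂ}
    (ht : ∀ i, bethe X v (Fin.cons (μ 0 - γ) fun k => y (i.succAbove k) : Fin (n + 1) → ℂ) ⬝ᵥ w =
      (∏ k, wtB (y (i.succAbove k) - μ 0)) * t i) :
    (∏ k : Fin L, wtA γ (μ k.succ - μ 0)) * (bethe X v y ⬝ᵥ w) =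
      -(∏ k, wtA γ (y k - μ 0)) * ∑ i, (∏ k, wtB (μ k - y i)) /
        (wtA γ (y i - μ 0) * wtB (y i - μ 0)) *
        (∏ k ∈ Finset.univ.erase i, wtA γ (y i - y k) / wtB (y i - y k)) * t i := by
  have hB : (∏ k, wtB (y k - μ 0)) ≠ 0 := Finset.prod_ne_zero_iff.2 fun k _ => (hy₀ k).2
  have hA : (∏ k, wtA γ (y k - μ 0)) ≠ 0 := Finset.prod_ne_zero_iff.2 fun k _ => (hy₀ k).1
  have hexpand := transpose_mulVec_dotProduct (Z (μ 0 - γ))ᵀ (bethe X v y) w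
  rw [Matrix.transpose_transpose, hw, dotProduct_zero, E.mulVec_bethe_cons y
    (fun i k hik => by rw [neg_one_mul, neg_sub]; exact hy k i hik.symm) _
    (fun i => by
      rw [neg_one_mul, neg_sub, wtB_sub_sub_of_shift]
      exact neg_ne_zero.2 (hy₀ i).1), sub_dotProduct, sum_dotProduct, sub_eq_zero] at hexpand
  simp only [smul_dotProduct, smul_eq_mul, ht, neg_one_mul, neg_sub, wtA_sub_sub_of_shift,
    wtB_sub_sub_of_shift _ (y _), neg_div_neg_eq] at hexpand
  have hsum : ∑ i, wtC γ / -wtA γ (y i - μ 0) * (∏ k, wtB (y i - μ k)) *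
        (∏ k ∈ Finset.univ.erase i, wtA γ (y i - y k) / wtB (y i - y k)) *
        ((∏ k, wtB (y (i.succAbove k) - μ 0)) * t i) =
      -((-1) ^ (L + 1) * wtC γ * ∏ k, wtB (y k - μ 0)) * ∑ i, (∏ k, wtB (μ k - y i)) /
        (wtA γ (y i - μ 0) * wtB (y i - μ 0)) *
        (∏ k ∈ Finset.univ.erase i, wtA γ (y i - y k) / wtB (y i - y k)) * t i := by
    rw [Finset.mul_sum]
    refine Finset.sum_congr rfl fun i _ => ?_
    rw [prod_succAbove_eq_div i (f := fun k => wtB (y k - μ 0)) (hy₀ i).2, prod_wtB_sub_comm,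
      Fintype.card_fin, div_neg, div_mul_eq_div_mul_one_div]
    ring
  rw [hsum, prod_wtB_shift_sub, Finset.prod_div_distrib] at hexpand
  refine mul_left_cancel₀ (mul_ne_zero (mul_ne_zero
    (pow_ne_zero (L + 1) (neg_ne_zero.2 one_ne_zero)) hc) (div_ne_zero hB hA))
    (Eq.trans ?_ (hexpand.trans ?_))
  · ring
  · field_simp

lemma scalarProduct_cons_right (hc : wtC γ ≠ 0) {n : ℕ} (X : Fin (n + 1) → ℂ) (Y : Fin n → ℂ)
    (hX : ∀ i k, i ≠ k → wtB (X i - X k) ≠ 0)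
    (hX₀ : ∀ i, wtA γ (X i - μ 0) ≠ 0 ∧ wtB (X i - μ 0) ≠ 0)
    (hY : ∀ i k, i ≠ k → wtB (Y i - Y k) ≠ 0)
    (hY₀ : ∀ i, wtA γ (Y i - μ 0) ≠ 0 ∧ wtB (Y i - μ 0) ≠ 0) :
    (∏ k : Fin L, wtA γ (μ k.succ - μ 0)) *
        scalarProduct γ μ X (Fin.cons (μ 0) Y : Fin (n + 1) → ℂ) =
      -(∏ k, wtA γ (X k - μ 0)) * ∑ i, (∏ k, wtB (μ k - X i)) /
        (wtA γ (X i - μ 0) * wtB (X i - μ 0)) *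
        (∏ k ∈ Finset.univ.erase i, wtA γ (X i - X k) / wtB (X i - X k)) *
        ((∏ k, wtA γ (Y k - μ 0)) * Vfun γ μ (fun k => X (i.succAbove k)) Y) := by
  rw [scalarProduct_eq_dotProduct]
  refine (exchange_transpose_opC_opD μ).dotProduct_bethe hc ?_ X hX hX₀ fun i => ?_
  · exact (exchange_opB_opD μ).mulVec_bethe_shift hc
      (Finset.prod_eq_zero (Finset.mem_univ 0) (by rw [sub_self, wtB_zero]))
      (block_shift_mul_block zero_ne_one) Y hY hY₀
  · rw [← scalarProduct_eq_dotProduct, scalarProduct_special_left, Finset.prod_mul_distrib,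
      mul_assoc]

lemma scalarProduct_cons_left (hc : wtC γ ≠ 0) {n : ℕ} (X : Fin n → ℂ) (Y : Fin (n + 1) → ℂ)
    (hX : ∀ i k, i ≠ k → wtB (X i - X k) ≠ 0)
    (hX₀ : ∀ i, wtA γ (X i - μ 0) ≠ 0 ∧ wtB (X i - μ 0) ≠ 0)
    (hY : ∀ i k, i ≠ k → wtB (Y i - Y k) ≠ 0)
    (hY₀ : ∀ i, wtA γ (Y i - μ 0) ≠ 0 ∧ wtB (Y i - μ 0) ≠ 0) :
    (∏ k : Fin L, wtA γ (μ k.succ - μ 0)) *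
        scalarProduct γ μ (Fin.cons (μ 0) X : Fin (n + 1) → ℂ) Y =
      -(∏ k, wtA γ (Y k - μ 0)) * ∑ j, (∏ k, wtB (μ k - Y j)) /
        (wtA γ (Y j - μ 0) * wtB (Y j - μ 0)) *
        (∏ k ∈ Finset.univ.erase j, wtA γ (Y j - Y k) / wtB (Y j - Y k)) *
        ((∏ k, wtA γ (X k - μ 0)) * Vfun γ μ X fun k => Y (j.succAbove k)) := by
  rw [scalarProduct_eq_dotProduct, dotProduct_comm]
  refine (exchange_opB_opD μ).dotProduct_bethe hc ?_ Y hY hY₀ fun j => ?_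
  · refine (exchange_transpose_opC_opD μ).mulVec_bethe_shift hc
      (Finset.prod_eq_zero (Finset.mem_univ 0) (by rw [sub_self, wtB_zero])) ?_ X hX hX₀
    rw [← Matrix.transpose_mul, ← (block_commute ..).eq, block_shift_mul_block one_ne_zero,
      Matrix.transpose_zero]
  · rw [dotProduct_comm, ← scalarProduct_eq_dotProduct, scalarProduct_special_right,
      Finset.prod_mul_distrib]
    ring

/-- Evaluates `⟨0| C(X₁) ⋯ C(X_n) A(μ₁) B(Y₁) ⋯ B(Y_n) |0⟩` in two ways, moving `A(μ₁)` to the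
left and to the right. -/
lemma scalarProduct_insert_opA (hc : wtC γ ≠ 0) {n : ℕ} (X Y : Fin (n + 1) → ℂ)
    (hX : ∀ i k, i ≠ k → wtB (X i - X k) ≠ 0) (hX₀ : ∀ i, wtB (X i - μ 0) ≠ 0)
    (hY : ∀ i k, i ≠ k → wtB (Y i - Y k) ≠ 0) (hY₀ : ∀ i, wtB (Y i - μ 0) ≠ 0) :
    (∏ k : Fin L, wtA γ (μ 0 - μ k.succ)) * Ffac γ μ X Y * scalarProduct γ μ X Y =
      (∑ i, (∏ k, wtA γ (X i - μ k)) / wtB (X i - μ 0) *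
        (∏ k ∈ Finset.univ.erase i, wtA γ (X k - X i) / wtB (X k - X i)) *
        scalarProduct γ μ (Fin.cons (μ 0) fun k => X (i.succAbove k) : Fin (n + 1) → ℂ) Y) -
      ∑ j, (∏ k, wtA γ (Y j - μ k)) / wtB (Y j - μ 0) *
        (∏ k ∈ Finset.univ.erase j, wtA γ (Y k - Y j) / wtB (Y k - Y j)) *
        scalarProduct γ μ X (Fin.cons (μ 0) fun k => Y (j.succAbove k) : Fin (n + 1) → ℂ) := by
  have h := transpose_mulVec_dotProduct (block γ μ (μ 0) 0 0) (leftBethe γ μ X)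
    (rightBethe γ μ Y)
  rw [(exchange_transpose_opC_opA μ).mulVec_bethe_cons X (by simpa only [one_mul] using hX) _
      (by simpa only [one_mul] using hX₀),
    (exchange_opB_opA μ).mulVec_bethe_cons Y (by simpa only [one_mul] using hY) _
      (by simpa only [one_mul] using hY₀),
    dotProduct_sub, dotProduct_sum, sub_dotProduct, sum_dotProduct] at h
  simp only [dotProduct_smul, smul_dotProduct, ← scalarProduct_eq_dotProduct, smul_eq_mul,
    one_mul, div_mul_eq_mul_div, mul_assoc, mul_div_assoc, ← Finset.mul_sum,
    Fin.prod_univ_succ (fun k => wtA γ (μ 0 - μ k)), sub_self, wtA_zero] at h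
  refine mul_left_cancel₀ hc ?_
  rw [Ffac]
  simp only [div_mul_eq_mul_div, mul_assoc, mul_div_assoc]
  linear_combination h

theorem scalarProduct_recursion {n : ℕ} (X Y : Fin (n + 1) → ℂ)
    (hμ : ∀ k : Fin L, wtA γ (μ 0 - μ k.succ) ≠ 0 ∧ wtA γ (μ k.succ - μ 0) ≠ 0)
    (hX₀ : ∀ i, wtA γ (X i - μ 0) ≠ 0 ∧ wtB (X i - μ 0) ≠ 0)
    (hY₀ : ∀ i, wtA γ (Y i - μ 0) ≠ 0 ∧ wtB (Y i - μ 0) ≠ 0)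
    (hX : ∀ i k, i ≠ k → wtB (X i - X k) ≠ 0) (hY : ∀ i k, i ≠ k → wtB (Y i - Y k) ≠ 0)
    (hF : Ffac γ μ X Y ≠ 0) :
    scalarProduct γ μ X Y = Kfac γ μ X Y * ∑ i, ∑ j, Omega γ μ X Y i j *
      Vfun γ μ (fun k => X (i.succAbove k)) (fun k => Y (j.succAbove k)) := by
  by_cases hc : wtC γ = 0
  · simp [scalarProduct_eq_zero μ hc, Vfun, recConst, hc]
  have hsub {y : Fin (n + 1) → ℂ} (hy : ∀ i k, i ≠ k → wtB (y i - y k) ≠ 0) (i : Fin (n + 1))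
      (k l : Fin n) (hkl : k ≠ l) : wtB (y (i.succAbove k) - y (i.succAbove l)) ≠ 0 :=
    hy _ _ (Fin.succAbove_right_injective.ne hkl)
  have hP₁ : (∏ k : Fin L, wtA γ (μ 0 - μ k.succ)) ≠ 0 :=
    Finset.prod_ne_zero_iff.2 fun k _ => (hμ k).1
  have hP₂ : (∏ k : Fin L, wtA γ (μ k.succ - μ 0)) ≠ 0 :=
    Finset.prod_ne_zero_iff.2 fun k _ => (hμ k).2
  have hinsert := eq_div_of_mul_eq (mul_ne_zero hP₁ hF) ((mul_comm _ _).trans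
    (scalarProduct_insert_opA hc X Y hX (fun i => (hX₀ i).2) hY fun j => (hY₀ j).2))
  have hright := fun j => eq_div_of_mul_eq hP₂ ((mul_comm _ _).trans
    (scalarProduct_cons_right hc X (fun k => Y (j.succAbove k)) hX hX₀ (hsub hY j) fun _ => hY₀ _))
  have hleft := fun i => eq_div_of_mul_eq hP₂ ((mul_comm _ _).trans
    (scalarProduct_cons_left hc (fun k => X (i.succAbove k)) Y (hsub hX i) (fun _ => hX₀ _) hY hY₀))
  rw [hinsert]
  simp only [hleft, hright]
  simp only [Finset.mul_sum, Finset.sum_div]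
  rw [Finset.sum_comm (f := fun j i => _ / wtB (Y j - μ 0) * _ * (_ / _)),
    ← Finset.sum_sub_distrib, Finset.sum_div]
  refine Finset.sum_congr rfl fun i _ => ?_
  rw [← Finset.sum_sub_distrib, Finset.sum_div]
  refine Finset.sum_congr rfl fun j _ => ?_
  rw [prod_succAbove_eq_div i (f := fun k => wtA γ (X k - μ 0)) (hX₀ i).1,
    prod_succAbove_eq_div j (f := fun k => wtA γ (Y k - μ 0)) (hY₀ j).1, Kfac, Omega]
  simp only [Finset.prod_mul_distrib]
  ring

end recursion

open Set

/-! ### Contour integrals -/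

/-- The entire function `sinh z / z`. -/
noncomputable def sinhDiv : ℂ → ℂ := dslope Complex.sinh 0

lemma wtB_eq_mul_sinhDiv (z : ℂ) : wtB z = z * sinhDiv z := by
  simpa [wtB, sinhDiv] using (sub_smul_dslope Complex.sinh 0 z).symm

lemma differentiable_sinhDiv : Differentiable ℂ sinhDiv := by
  rw [← differentiableOn_univ, sinhDiv, Complex.differentiableOn_dslope Filter.univ_mem]
  exact Complex.differentiable_sinh.differentiableOn

lemma sinhDiv_zero : sinhDiv 0 = 1 := by simp [sinhDiv]

lemma sinhDiv_ne_zero_iff {z : ℂ} : sinhDiv z ≠ 0 ↔ (wtB z = 0 → z = 0) := by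
  rw [wtB_eq_mul_sinhDiv, mul_eq_zero]
  refine ⟨fun h h' => h'.resolve_right h, fun h h' => ?_⟩
  rw [h (Or.inr h'), sinhDiv_zero] at h'
  exact one_ne_zero h'

lemma circleIntegral_eq_zero_of_differentiableOn {E : Type*} [NormedAddCommGroup E]
    [NormedSpace ℂ E] {f : ℂ → E} {c : ℂ} {r : ℝ} (hr : 0 ≤ r)
    (hf : DifferentiableOn ℂ f (Metric.closedBall c r)) : circleIntegral f c r = 0 :=
  ((hf.mono Metric.closure_ball_subset_closedBall).diffContOnCl).circleIntegral_eq_zero hr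

namespace Contour

lemma sphere_subset_trace (Γ : Contour) (j : Fin Γ.m) :
    Metric.sphere (Γ.center j) (Γ.radius j) ⊆ Γ.trace := subset_iUnion_of_subset j subset_rfl

lemma closedBall_subset_filled (Γ : Contour) (j : Fin Γ.m) :
    Metric.closedBall (Γ.center j) (Γ.radius j) ⊆ Γ.filled := subset_iUnion_of_subset j subset_rfl

lemma trace_subset_filled (Γ : Contour) : Γ.trace ⊆ Γ.filled :=
  iUnion_mono fun _ => Metric.sphere_subset_closedBall

lemma inside_subset_filled (Γ : Contour) : Γ.inside ⊆ Γ.filled :=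
  iUnion_mono fun _ => Metric.ball_subset_closedBall

lemma isOpen_inside (Γ : Contour) : IsOpen Γ.inside := isOpen_iUnion fun _ => Metric.isOpen_ball

lemma isCompact_filled (Γ : Contour) : IsCompact Γ.filled :=
  isCompact_iUnion fun _ => isCompact_closedBall _ _

lemma filled_subset_closure_inside (Γ : Contour) : Γ.filled ⊆ closure Γ.inside := by
  refine iUnion_subset fun j => ?_
  rw [← closure_ball _ (Γ.radius_pos j).ne']
  exact closure_mono (subset_iUnion_of_subset j subset_rfl)

lemma ne_of_mem_trace_of_mem_inside {Γ : Contour} {z c : ℂ} (hz : z ∈ Γ.trace)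
    (hc : c ∈ Γ.inside) : z ≠ c := by
  rintro rfl
  obtain ⟨j, hj⟩ := mem_iUnion.1 hz
  obtain ⟨k, hk⟩ := mem_iUnion.1 hc
  rcases eq_or_ne j k with rfl | h
  · exact (Metric.mem_ball.1 hk).ne (Metric.mem_sphere.1 hj)
  · exact (Γ.disjoint h).le_bot ⟨Metric.sphere_subset_closedBall hj,
      Metric.ball_subset_closedBall hk⟩

lemma integral_congr (Γ : Contour) {f g : ℂ → ℂ} (h : EqOn f g Γ.trace) :
    Γ.integral f = Γ.integral g := by
  unfold Contour.integral
  refine Finset.sum_congr rfl fun j _ => ?_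
  rw [circleIntegral.integral_congr (Γ.radius_pos j).le (h.mono (Γ.sphere_subset_trace j))]

lemma integral_const_mul (Γ : Contour) (a : ℂ) (f : ℂ → ℂ) :
    Γ.integral (fun z => a * f z) = a * Γ.integral f := by
  unfold Contour.integral
  rw [Finset.mul_sum]
  refine Finset.sum_congr rfl fun j _ => ?_
  rw [circleIntegral.integral_const_mul]
  ring

lemma integral_sum (Γ : Contour) {ι : Type*} (s : Finset ι) (f : ι → ℂ → ℂ)
    (hf : ∀ i ∈ s, ContinuousOn (f i) Γ.trace) :
    Γ.integral (fun z => ∑ i ∈ s, f i z) = ∑ i ∈ s, Γ.integral (f i) := by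
  unfold Contour.integral
  rw [Finset.sum_comm]
  refine Finset.sum_congr rfl fun j _ => ?_
  rw [circleIntegral.integral_fun_sum, Finset.mul_sum]
  exact fun i hi => ((hf i hi).mono (Γ.sphere_subset_trace j)).circleIntegrable
    (Γ.radius_pos j).le

lemma integral_inv_sub_mul {Γ : Contour} {f : ℂ → ℂ} (hf : DifferentiableOn ℂ f Γ.filled) {c : ℂ}
    (hc : c ∈ Γ.inside) : Γ.integral (fun z => (z - c)⁻¹ * f z) = f c := by
  obtain ⟨k, hk⟩ := mem_iUnion.1 hc
  unfold Contour.integral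
  rw [Finset.sum_eq_single k]
  · have := (hf.mono (Γ.closedBall_subset_filled k)).circleIntegral_sub_inv_smul hk
    simp only [smul_eq_mul] at this
    rw [this, inv_mul_cancel_left₀ Complex.two_pi_I_ne_zero]
  · intro j _ hj
    have hne : ∀ z ∈ Metric.closedBall (Γ.center j) (Γ.radius j), z - c ≠ 0 := by
      intro z hz h
      rw [sub_eq_zero.1 h] at hz
      exact (Γ.disjoint hj).le_bot ⟨hz, Metric.ball_subset_closedBall hk⟩
    rw [circleIntegral_eq_zero_of_differentiableOn (Γ.radius_pos j).le, mul_zero]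
    exact ((differentiableOn_id.sub_const c).inv hne).mul (hf.mono (Γ.closedBall_subset_filled j))
  · simp

lemma integral_eq_zero {Γ : Contour} {f : ℂ → ℂ} (hf : DifferentiableOn ℂ f Γ.filled) :
    Γ.integral f = 0 := by
  refine Finset.sum_eq_zero fun j _ => ?_
  rw [circleIntegral_eq_zero_of_differentiableOn (Γ.radius_pos j).le
    (hf.mono (Γ.closedBall_subset_filled j)), mul_zero]

end Contour

lemma inv_prod_sub_eq_sum {n : ℕ} [NeZero n] {c : Fin n → ℂ} (hc : Function.Injective c) {z : ℂ}
    (hz : ∀ j, z ≠ c j) :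
    (∏ j, (z - c j))⁻¹ = ∑ j, (∏ k ∈ Finset.univ.erase j, (c j - c k))⁻¹ * (z - c j)⁻¹ := by
  have h := congrArg (Polynomial.eval z) (Lagrange.sum_basis (s := Finset.univ) (v := c)
    hc.injOn Finset.univ_nonempty)
  simp only [Polynomial.eval_finsetSum, Polynomial.eval_one,
    Lagrange.eval_basis_not_at_node (Finset.mem_univ _) (hz _), ← Finset.mul_sum,
    Lagrange.eval_nodal, Lagrange.nodalWeight, Finset.prod_inv_distrib] at h
  exact inv_eq_of_mul_eq_one_right h

lemma Contour.integral_div_prod_wtB {Γ : Contour} {n : ℕ} {c : Fin n → ℂ}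
    (hc : Function.Injective c) (mem : ∀ j, c j ∈ Γ.inside)
    (only : ∀ z ∈ Γ.filled, ∀ j, wtB (z - c j) = 0 → z = c j) {F : ℂ → ℂ}
    (hF : DifferentiableOn ℂ F Γ.filled) :
    Γ.integral (fun z => F z / ∏ j, wtB (z - c j)) =
      ∑ j, F (c j) / ∏ k ∈ Finset.univ.erase j, wtB (c j - c k) := by
  obtain _ | n := n
  · simpa using Contour.integral_eq_zero hF
  have hs : ∀ z ∈ Γ.filled, ∀ j, sinhDiv (z - c j) ≠ 0 := fun z hz j =>
    sinhDiv_ne_zero_iff.2 fun h => sub_eq_zero.2 (only z hz j h)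
  set g : ℂ → ℂ := fun z => F z / ∏ j, sinhDiv (z - c j) with hg
  have hgd : DifferentiableOn ℂ g Γ.filled := by
    refine hF.div (DifferentiableOn.fun_finsetProd fun j _ => ?_)
      fun z hz => Finset.prod_ne_zero_iff.2 fun j _ => hs z hz j
    exact (differentiable_sinhDiv.comp (differentiable_id.sub_const _)).differentiableOn
  have hpartial : EqOn (fun z => F z / ∏ j, wtB (z - c j)) (fun z => ∑ j,
      (∏ k ∈ Finset.univ.erase j, (c j - c k))⁻¹ * ((z - c j)⁻¹ * g z)) Γ.trace := by
    intro z hz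
    have hne : ∀ j, z ≠ c j := fun j => Contour.ne_of_mem_trace_of_mem_inside hz (mem j)
    simp only [← mul_assoc, ← Finset.sum_mul, ← inv_prod_sub_eq_sum hc hne, hg,
      wtB_eq_mul_sinhDiv, Finset.prod_mul_distrib]
    rw [div_mul_eq_div_div_swap, inv_mul_eq_div]
  have hcont : ∀ j, ContinuousOn (fun z => (∏ k ∈ Finset.univ.erase j, (c j - c k))⁻¹ *
      ((z - c j)⁻¹ * g z)) Γ.trace := fun j => by
    refine continuousOn_const.mul (ContinuousOn.mul (ContinuousOn.inv₀ (by fun_prop) fun z hz => ?_)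
      (hgd.continuousOn.mono Γ.trace_subset_filled))
    exact sub_ne_zero.2 (Contour.ne_of_mem_trace_of_mem_inside hz (mem j))
  rw [Γ.integral_congr hpartial, Γ.integral_sum _ _ fun j _ => hcont j]
  refine Finset.sum_congr rfl fun j _ => ?_
  rw [Γ.integral_const_mul, Contour.integral_inv_sub_mul hgd (mem j), hg]
  simp only [wtB_eq_mul_sinhDiv, Finset.prod_mul_distrib]
  rw [← Finset.mul_prod_erase Finset.univ (fun k => sinhDiv (c j - c k)) (Finset.mem_univ j),
    sub_self, sinhDiv_zero, one_mul, div_mul_eq_div_div_swap, inv_mul_eq_div]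

/-! ### Multiple contour integrals -/

lemma sum_pi_fin_succ {α M : Type*} [Fintype α] [AddCommMonoid M] {m : ℕ}
    (F : (Fin (m + 1) → α) → M) : ∑ s, F s = ∑ a : α, ∑ s : Fin m → α, F (Fin.cons a s) := by
  rw [← Fintype.sum_prod_type']
  exact (Equiv.sum_comp (Fin.consEquiv fun _ : Fin (m + 1) => α) F).symm

lemma forall_cons_mem {α : Type*} {m : ℕ} {K : Fin (m + 1) → Set α} {z : α} {w : Fin m → α}
    (hz : z ∈ K 0) (hw : ∀ i, w i ∈ K i.succ) (i : Fin (m + 1)) :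
    (Fin.cons z w : Fin (m + 1) → α) i ∈ K i :=
  Fin.cases hz hw i

lemma multiIntegral_congr {m : ℕ} (Γ : Fin m → Contour) {F G : (Fin m → ℂ) → ℂ}
    (h : ∀ w, (∀ i, w i ∈ (Γ i).trace) → F w = G w) :
    multiIntegral Γ F = multiIntegral Γ G := by
  induction m with
  | zero => exact h _ fun i => i.elim0
  | succ m ih =>
    exact (Γ 0).integral_congr fun z hz => ih _ fun w hw => h _ (forall_cons_mem hz hw)

lemma multiIntegral_const_mul {m : ℕ} (Γ : Fin m → Contour) (a : ℂ) (F : (Fin m → ℂ) → ℂ) :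
    multiIntegral Γ (fun w => a * F w) = a * multiIntegral Γ F := by
  induction m with
  | zero => rfl
  | succ m ih =>
    simp only [multiIntegral, ih]
    exact Contour.integral_const_mul _ _ _

lemma multiIntegral_zero {m : ℕ} (Γ : Fin m → Contour) : multiIntegral Γ (fun _ => 0) = 0 := by
  simpa using multiIntegral_const_mul Γ 0 (fun _ => 0)

lemma analyticAt_comp_cons {m : ℕ} {F : (Fin (m + 1) → ℂ) → ℂ} {z : ℂ} {w : Fin m → ℂ}
    (hF : AnalyticAt ℂ F (Fin.cons z w)) :
    AnalyticAt ℂ (fun p : ℂ × (Fin m → ℂ) => F (Fin.cons p.1 p.2)) (z, w) := by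
  refine hF.fun_comp (f := fun p : ℂ × (Fin m → ℂ) => (Fin.cons p.1 p.2 : Fin (m + 1) → ℂ)) <|
    AnalyticAt.pi <| Fin.cases analyticAt_fst fun i => ?_
  exact ((ContinuousLinearMap.proj (R := ℂ) (φ := fun _ : Fin m => ℂ) i).comp
    (ContinuousLinearMap.snd ℂ ℂ (Fin m → ℂ))).analyticAt _

/-- The product of the factors `b(c_{f(i)} - c_k)`, `k ≠ f(i)`, which remain in the denominator of
the multiple residue at `w_i = c_{f(i)}` of `1 / ∏ b(w_i - c_k)`. -/
def residueDenom {m n : ℕ} (c : Fin n → ℂ) (f : Fin m → Fin n) : ℂ :=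
  ∏ i, ∏ k ∈ Finset.univ.erase (f i), wtB (c (f i) - c k)

lemma residueDenom_succ {m n : ℕ} (c : Fin n → ℂ) (f : Fin (m + 1) → Fin n) :
    residueDenom c f =
      (∏ k ∈ Finset.univ.erase (f 0), wtB (c (f 0) - c k)) *
        residueDenom c fun i => f i.succ := by
  rw [residueDenom, Fin.prod_univ_succ, residueDenom]

lemma multiIntegral_div_prod_wtB {m n : ℕ} {Γ : Fin m → Contour} {c : Fin n → ℂ}
    (hc : Function.Injective c) (mem : ∀ i j, c j ∈ (Γ i).inside)
    (only : ∀ i, ∀ z ∈ (Γ i).filled, ∀ j, wtB (z - c j) = 0 → z = c j) {F : (Fin m → ℂ) → ℂ}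
    (hF : AnalyticOnNhd ℂ F {w | ∀ i, w i ∈ (Γ i).filled}) :
    multiIntegral Γ (fun w => F w / ∏ i, ∏ j, wtB (w i - c j)) =
      ∑ f : Fin m → Fin n, F (c ∘ f) / residueDenom c f := by
  induction m with
  | zero => simp [multiIntegral, residueDenom, Subsingleton.elim (c ∘ _) Fin.elim0]
  | succ m ih =>
    have hF' {z : ℂ} {w : Fin m → ℂ} (hz : z ∈ (Γ 0).filled) (hw : ∀ i, w i ∈ (Γ i.succ).filled) :=
      analyticAt_comp_cons (hF (Fin.cons z w) (forall_cons_mem hz hw))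
    have hinner : EqOn (fun z => multiIntegral (fun i => Γ i.succ) fun w =>
          F (Fin.cons z w : Fin (m + 1) → ℂ) /
            ∏ i, ∏ j, wtB ((Fin.cons z w : Fin (m + 1) → ℂ) i - c j))
        (fun z => (∑ f : Fin m → Fin n, F (Fin.cons z (c ∘ f)) / residueDenom c f) /
          ∏ j, wtB (z - c j))
        (Γ 0).trace := by
      intro z hz
      simp only [Fin.prod_univ_succ, Fin.cons_zero, Fin.cons_succ]
      rw [← ih (Γ := fun i => Γ i.succ) (F := fun w => F (Fin.cons z w)) (fun i => mem _)
        (fun i => only _) fun w hw => (hF' ((Γ 0).trace_subset_filled hz) hw).curry_right,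
        div_eq_inv_mul, ← multiIntegral_const_mul]
      simp only [div_eq_inv_mul, mul_inv, mul_assoc]
    have houter : DifferentiableOn ℂ (fun z => ∑ f : Fin m → Fin n,
        F (Fin.cons z (c ∘ f)) / residueDenom c f) (Γ 0).filled :=
      DifferentiableOn.fun_sum fun f _ => DifferentiableOn.div_const (fun z hz =>
        (hF' hz fun i => (Γ i.succ).inside_subset_filled (mem _ _)).curry_left.differentiableAt
          |>.differentiableWithinAt) _
    refine ((Γ 0).integral_congr hinner).trans ?_
    rw [Contour.integral_div_prod_wtB hc (mem 0) (only 0) houter, sum_pi_fin_succ]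
    simp only [Finset.sum_div]
    refine Finset.sum_congr rfl fun j _ => Finset.sum_congr rfl fun f _ => ?_
    simp only [residueDenom_succ, Fin.cons_zero, Fin.cons_succ, div_mul_eq_div_div_swap,
      Fin.comp_cons]

lemma continuous_multiIntegral {X : Type*} [TopologicalSpace X] {m : ℕ} (Γ : Fin m → Contour)
    {F : X → (Fin m → ℂ) → ℂ}
    (hF : Continuous fun p : X × {w : Fin m → ℂ // ∀ i, w i ∈ (Γ i).trace} => F p.1 p.2.1) :
    Continuous fun x => multiIntegral Γ (F x) := by
  induction m generalizing X with
  | zero => exact hF.comp (f := fun x => (x, ⟨Fin.elim0, fun i => i.elim0⟩)) (by fun_prop)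
  | succ m ih =>
    simp only [multiIntegral, Contour.integral, circleIntegral]
    refine continuous_finsetSum _ fun j _ => continuous_const.mul <|
      intervalIntegral.continuous_parametric_intervalIntegral_of_continuous' ?_ _ _
    set C := circleMap ((Γ 0).center j) ((Γ 0).radius j) with hC
    have hCt (θ : ℝ) : C θ ∈ (Γ 0).trace :=
      (Γ 0).sphere_subset_trace j (circleMap_mem_sphere _ ((Γ 0).radius_pos j).le _)
    have hcons : Continuous fun p : (X × ℝ) × {w : Fin m → ℂ // ∀ i, w i ∈ (Γ i.succ).trace} =>
        (Fin.cons (C p.1.2) p.2.1 : Fin (m + 1) → ℂ) :=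
      ((continuous_circleMap _ _).comp continuous_fst.snd).finCons
        (continuous_subtype_val.comp continuous_snd)
    have hinner : Continuous fun p : X × ℝ =>
        multiIntegral (fun i => Γ i.succ) fun w => F p.1 (Fin.cons (C p.2) w) :=
      ih (X := X × ℝ) (fun i => Γ i.succ) <| hF.comp <| continuous_fst.fst.prodMk <|
        hcons.subtype_mk fun p => forall_cons_mem (hCt p.1.2) p.2.2
    have hderiv : Continuous fun p : X × ℝ => deriv C p.2 := by
      simp only [hC, deriv_circleMap]
      fun_prop
    exact hderiv.smul hinner

/-! ### The kernel as a quotient of entire functions -/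

/-- `R_i`, multiplied by its denominators. -/
def Rnum (γ : ℂ) {L n : ℕ} (h : n ≤ L) (μ : Fin L → ℂ) (w v : Fin n → ℂ)
    (i : Fin n) : ℂ :=
  (∏ k ∈ Finset.Ici i, wtA γ (w k - μ (Fin.castLE h i)) * wtB (v k - μ (Fin.castLE h i)))
  - ∏ k ∈ Finset.Ici i, wtA γ (v k - μ (Fin.castLE h i)) * wtB (w k - μ (Fin.castLE h i))

/-- `Λ_i`, multiplied by its denominators. -/
def Lnum (γ : ℂ) {L n : ℕ} (h : n ≤ L) (μ : Fin L → ℂ) (w v : Fin n → ℂ)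
    (i : Fin n) : ℂ :=
  (∏ k ∈ Finset.Ici (Fin.castLE h i), wtA γ (v i - μ k) * wtB (μ k - w i))
    * (∏ k ∈ Finset.Ioi i, -(wtA γ (w i - w k) * wtA γ (v k - v i)))
  - (∏ k ∈ Finset.Ici (Fin.castLE h i), wtA γ (w i - μ k) * wtB (μ k - v i))
    * (∏ k ∈ Finset.Ioi i, -(wtA γ (w k - w i) * wtA γ (v i - v k)))

/-- The contribution of a pair `i < j` to the numerator `Hnum` of the kernel. -/
def pairNum (γ : ℂ) {L n : ℕ} (h : n ≤ L) (μ : Fin L → ℂ) (w v : Fin n → ℂ)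
    (i j : Fin n) : ℂ :=
  wtB (w i - w j) * wtB (v i - v j) * (wtA γ (w j - μ (Fin.castLE h i)) *
    wtA γ (v j - μ (Fin.castLE h i)) * (wtB (w j - μ (Fin.castLE h i)) *
    wtB (v j - μ (Fin.castLE h i))))

/-- The numerator of the kernel `H` over the denominator `∏ i, Rnum i`; like `Rnum` it is an
entire function. -/
def Hnum (γ : ℂ) {L n : ℕ} (h : n ≤ L) (μ : Fin L → ℂ) (w v : Fin n → ℂ) : ℂ :=
  (-1) ^ (L * n + n * (n + 1) / 2) * wtC γ ^ (2 * n) *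
    ∏ i, (∏ j ∈ Finset.Ioi i, pairNum γ h μ w v i j) * Lnum γ h μ w v i

section kernel
variable {γ : ℂ} {L n : ℕ} {h : n ≤ L} {μ : Fin L → ℂ} {w v : Fin n → ℂ}

lemma Rfac_eq_div (i : Fin n) (hb : ∀ k, i ≤ k →
      wtB (w k - μ (Fin.castLE h i)) ≠ 0 ∧ wtB (v k - μ (Fin.castLE h i)) ≠ 0) :
    Rfac γ h μ w v i = Rnum γ h μ w v i /
      ∏ k ∈ Finset.Ici i, wtB (w k - μ (Fin.castLE h i)) * wtB (v k - μ (Fin.castLE h i)) := by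
  rw [Rfac, Rnum, sub_div, ← Finset.prod_div_distrib, ← Finset.prod_div_distrib]
  congr 1 <;> refine Finset.prod_congr rfl fun k hk => ?_ <;>
    obtain ⟨hwk, hvk⟩ := hb k (Finset.mem_Ici.1 hk) <;> field_simp

lemma Lfac_eq_div (i : Fin n) :
    Lfac γ h μ w v i = Lnum γ h μ w v i /
      ∏ k ∈ Finset.Ioi i, wtB (w i - w k) * wtB (v i - v k) := by
  rw [Lfac, Lnum, sub_div, mul_div_assoc, mul_div_assoc, ← Finset.prod_div_distrib,
    ← Finset.prod_div_distrib]
  congr 2 <;> refine Finset.prod_congr rfl fun k _ => ?_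
  · rw [← neg_sub (v i) (v k), wtB_neg, div_mul_div_comm, mul_neg, div_neg, neg_div]
  · rw [← neg_sub (w i) (w k), wtB_neg, div_mul_div_comm, neg_mul, div_neg, neg_div]

lemma Hker_eq_div (hb : ∀ i k, i ≤ k →
      wtB (w k - μ (Fin.castLE h i)) ≠ 0 ∧ wtB (v k - μ (Fin.castLE h i)) ≠ 0)
    (hd : ∀ i k, i < k → wtB (w i - w k) ≠ 0 ∧ wtB (v i - v k) ≠ 0) :
    Hker γ h μ w v = Hnum γ h μ w v / ∏ i, Rnum γ h μ w v i := by
  rw [Hker, Hnum, ← Finset.prod_div_distrib, mul_assoc _ (∏ i, _), mul_div_assoc,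
    ← Finset.prod_div_distrib, ← Finset.prod_mul_distrib]
  congr 1
  refine Finset.prod_congr rfl fun i _ => ?_
  rw [Rfac_eq_div i (hb i), Lfac_eq_div, ← Finset.mul_prod_Ioi_eq_prod_Ici]
  simp only [pairNum, Finset.prod_mul_distrib, Finset.prod_pow]
  have hw : ∏ k ∈ Finset.Ioi i, wtB (w i - w k) ≠ 0 := Finset.prod_ne_zero_iff.2 fun k hk =>
    (hd i k (Finset.mem_Ioi.1 hk)).1
  have hv : ∏ k ∈ Finset.Ioi i, wtB (v i - v k) ≠ 0 := Finset.prod_ne_zero_iff.2 fun k hk =>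
    (hd i k (Finset.mem_Ioi.1 hk)).2
  obtain ⟨hwi, hvi⟩ := hb i i le_rfl
  generalize Rnum γ h μ w v i = R
  rw [inv_div]
  field_simp

lemma Hnum_eq_zero {i k : Fin n} (hik : i < k)
    (h0 : wtB (w i - w k) = 0 ∨ wtB (v i - v k) = 0) : Hnum γ h μ w v = 0 := by
  have hpair : pairNum γ h μ w v i k = 0 := by rw [pairNum, mul_eq_zero.2 h0, zero_mul]
  rw [Hnum, Finset.prod_eq_zero (Finset.mem_univ i), mul_zero]
  rw [Finset.prod_eq_zero (Finset.mem_Ioi.2 hik) hpair, zero_mul]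

lemma Hker_eq_zero {i k : Fin n} (hik : i < k)
    (h0 : wtB (w i - w k) = 0 ∨ wtB (v i - v k) = 0) : Hker γ h μ w v = 0 := by
  have hnumerator : (∏ i, ∏ j ∈ Finset.Ioi i, wtB (w i - w j) ^ 2 * wtB (v i - v j) ^ 2
      * wtA γ (w j - μ (Fin.castLE h i)) * wtA γ (v j - μ (Fin.castLE h i))) = 0 :=
    Finset.prod_eq_zero (Finset.mem_univ i) <| Finset.prod_eq_zero (Finset.mem_Ioi.2 hik) <| by
      rcases h0 with h0 | h0 <;> simp [h0]
  rw [Hker, hnumerator, zero_div, mul_zero, zero_mul]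

-- Where two of the `w` (or of the `w̄`) collide, both sides vanish.
lemma Hker_eq_div_of_denomsNonzero (hD : DenomsNonzero γ h μ w v) :
    Hker γ h μ w v = Hnum γ h μ w v / ∏ i, Rnum γ h μ w v i := by
  by_cases hd : ∀ i k, i < k → wtB (w i - w k) ≠ 0 ∧ wtB (v i - v k) ≠ 0
  · exact Hker_eq_div hD.1 hd
  · push Not at hd
    obtain ⟨i, k, hik, h0⟩ := hd
    have h0 : wtB (w i - w k) = 0 ∨ wtB (v i - v k) = 0 := or_iff_not_imp_left.2 h0
    rw [Hker_eq_zero hik h0, Hnum_eq_zero hik h0, zero_div]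

lemma Rnum_ne_zero_of_denomsNonzero (hD : DenomsNonzero γ h μ w v) (i : Fin n) :
    Rnum γ h μ w v i ≠ 0 := by
  intro h0
  apply hD.2 i
  rw [Rfac_eq_div i (hD.1 i), h0, zero_div]

lemma denomsNonzero_of_Rnum_ne_zero (hb : ∀ i k, i ≤ k →
      wtB (w k - μ (Fin.castLE h i)) ≠ 0 ∧ wtB (v k - μ (Fin.castLE h i)) ≠ 0)
    (hR : ∀ i, Rnum γ h μ w v i ≠ 0) : DenomsNonzero γ h μ w v := by
  refine ⟨hb, fun i => ?_⟩
  rw [Rfac_eq_div i (hb i)]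
  exact div_ne_zero (hR i) (Finset.prod_ne_zero_iff.2 fun k hk =>
    mul_ne_zero (hb i k (Finset.mem_Ici.1 hk)).1 (hb i k (Finset.mem_Ici.1 hk)).2)

end kernel

/-! ### Analyticity -/

section analytic
variable {E : Type*} [NormedAddCommGroup E] [NormedSpace ℂ E] {f g : E → ℂ} {x : E}

lemma analyticAt_wtA_sub (γ : ℂ) (hf : AnalyticAt ℂ f x) (hg : AnalyticAt ℂ g x) :
    AnalyticAt ℂ (fun y => wtA γ (f y - g y)) x :=
  (analyticAt_sinh _).fun_comp (f := fun y => f y - g y + γ) ((hf.sub hg).add analyticAt_const)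

lemma analyticAt_wtB_sub (hf : AnalyticAt ℂ f x) (hg : AnalyticAt ℂ g x) :
    AnalyticAt ℂ (fun y => wtB (f y - g y)) x :=
  (analyticAt_sinh _).fun_comp (f := fun y => f y - g y) (hf.sub hg)

variable {γ : ℂ} {L n : ℕ} {h : n ≤ L} {μ : Fin L → ℂ} {w v : E → Fin n → ℂ}

lemma analyticAt_Rnum (hw : ∀ k, AnalyticAt ℂ (fun y => w y k) x)
    (hv : ∀ k, AnalyticAt ℂ (fun y => v y k) x) (i : Fin n) :
    AnalyticAt ℂ (fun y => Rnum γ h μ (w y) (v y) i) x := by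
  refine .sub (Finset.analyticAt_fun_prod _ fun k _ => ?_)
    (Finset.analyticAt_fun_prod _ fun k _ => ?_)
  · exact (analyticAt_wtA_sub γ (hw k) analyticAt_const).mul
      (analyticAt_wtB_sub (hv k) analyticAt_const)
  · exact (analyticAt_wtA_sub γ (hv k) analyticAt_const).mul
      (analyticAt_wtB_sub (hw k) analyticAt_const)

lemma analyticAt_Hnum (hw : ∀ k, AnalyticAt ℂ (fun y => w y k) x)
    (hv : ∀ k, AnalyticAt ℂ (fun y => v y k) x) :
    AnalyticAt ℂ (fun y => Hnum γ h μ (w y) (v y)) x := by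
  have hc : ∀ z : ℂ, AnalyticAt ℂ (fun _ : E => z) x := fun z => analyticAt_const
  refine analyticAt_const.mul (Finset.analyticAt_fun_prod _ fun i _ => .mul
    (Finset.analyticAt_fun_prod _ fun k _ => ?_) (.sub (.mul (Finset.analyticAt_fun_prod _
      fun k _ => ?_) (Finset.analyticAt_fun_prod _ fun k _ => ?_)) (.mul
      (Finset.analyticAt_fun_prod _ fun k _ => ?_) (Finset.analyticAt_fun_prod _ fun k _ => ?_))))
  · exact ((analyticAt_wtB_sub (hw _) (hw _)).mul (analyticAt_wtB_sub (hv _) (hv _))).mul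
      (((analyticAt_wtA_sub _ (hw _) (hc _)).mul (analyticAt_wtA_sub _ (hv _) (hc _))).mul
      ((analyticAt_wtB_sub (hw _) (hc _)).mul (analyticAt_wtB_sub (hv _) (hc _))))
  · exact (analyticAt_wtA_sub _ (hv _) (hc _)).mul (analyticAt_wtB_sub (hc _) (hw _))
  · exact ((analyticAt_wtA_sub _ (hw _) (hw _)).mul (analyticAt_wtA_sub _ (hv _) (hv _))).neg
  · exact (analyticAt_wtA_sub _ (hw _) (hc _)).mul (analyticAt_wtB_sub (hc _) (hv _))
  · exact ((analyticAt_wtA_sub _ (hw _) (hw _)).mul (analyticAt_wtA_sub _ (hv _) (hv _))).neg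

end analytic

lemma analyticAt_fst_apply {n : ℕ} (k : Fin n) (x : (Fin n → ℂ) × (Fin n → ℂ)) :
    AnalyticAt ℂ (fun p : (Fin n → ℂ) × (Fin n → ℂ) => p.1 k) x :=
  ((ContinuousLinearMap.proj (R := ℂ) (φ := fun _ : Fin n => ℂ) k).comp
    (ContinuousLinearMap.fst ℂ (Fin n → ℂ) (Fin n → ℂ))).analyticAt x

lemma analyticAt_snd_apply {n : ℕ} (k : Fin n) (x : (Fin n → ℂ) × (Fin n → ℂ)) :
    AnalyticAt ℂ (fun p : (Fin n → ℂ) × (Fin n → ℂ) => p.2 k) x :=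
  ((ContinuousLinearMap.proj (R := ℂ) (φ := fun _ : Fin n => ℂ) k).comp
    (ContinuousLinearMap.snd ℂ (Fin n → ℂ) (Fin n → ℂ))).analyticAt x

/-! ### Recursions for the kernel -/

lemma prod_Ici_zero {M : Type*} [CommMonoid M] {n : ℕ} (f : Fin (n + 1) → M) :
    ∏ k ∈ Finset.Ici 0, f k = ∏ k, f k := by
  rw [← bot_eq_zero, Finset.Ici_bot]

lemma neg_one_pow_succ_mul_succ (L n : ℕ) :
    (-1 : ℂ) ^ ((L + 1) * (n + 1) + (n + 1) * (n + 1 + 1) / 2) =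
      (-1) ^ L * (-1) ^ (L * n + n * (n + 1) / 2) := by
  have htriangle : (n + 1) * (n + 1 + 1) / 2 = n * (n + 1) / 2 + (n + 1) := by
    rw [show (n + 1) * (n + 1 + 1) = n * (n + 1) + (n + 1) * 2 by ring,
      Nat.add_mul_div_right _ _ two_pos]
  rw [htriangle, show (L + 1) * (n + 1) + (n * (n + 1) / 2 + (n + 1)) =
    L + (L * n + n * (n + 1) / 2) + 2 * (n + 1) by ring, pow_add, pow_mul, neg_one_sq, one_pow,
    mul_one, pow_add]

section kernelRecursion
variable (γ : ℂ) {L n : ℕ} (h : n + 1 ≤ L + 1) (μ : Fin (L + 1) → ℂ) (w v : Fin (n + 1) → ℂ)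

lemma Rfac_zero : Rfac γ h μ w v 0 = Ffac γ μ w v := by
  simp only [Rfac, prod_Ici_zero, Fin.castLE_zero, Ffac]

lemma Rfac_succ (i : Fin n) : Rfac γ h μ w v i.succ = Rfac γ (Nat.le_of_succ_le_succ h)
    (fun k => μ k.succ) (fun k => w k.succ) (fun k => v k.succ) i := by
  simp only [Rfac, Fin.prod_Ici_succ, Fin.castLE_succ]

lemma Lfac_zero : Lfac γ h μ w v 0 =
    (∏ k, wtA γ (v 0 - μ k) * wtB (μ k - w 0))
        * (∏ k : Fin n, wtA γ (w 0 - w k.succ) / wtB (w 0 - w k.succ))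
        * (∏ k : Fin n, wtA γ (v k.succ - v 0) / wtB (v k.succ - v 0))
      - (∏ k, wtA γ (w 0 - μ k) * wtB (μ k - v 0))
        * (∏ k : Fin n, wtA γ (w k.succ - w 0) / wtB (w k.succ - w 0))
        * (∏ k : Fin n, wtA γ (v 0 - v k.succ) / wtB (v 0 - v k.succ)) := by
  simp only [Lfac, Fin.castLE_zero, prod_Ici_zero, Fin.prod_Ioi_zero,
    Finset.prod_mul_distrib, mul_assoc]

lemma Lfac_succ (i : Fin n) : Lfac γ h μ w v i.succ = Lfac γ (Nat.le_of_succ_le_succ h)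
    (fun k => μ k.succ) (fun k => w k.succ) (fun k => v k.succ) i := by
  simp only [Lfac, Fin.prod_Ici_succ, Fin.prod_Ioi_succ, Fin.castLE_succ]

lemma Hker_succ : Hker γ h μ w v =
    (-1) ^ L * wtC γ ^ 2 * Hker γ (Nat.le_of_succ_le_succ h) (fun k => μ k.succ)
        (fun k => w k.succ) (fun k => v k.succ) / (wtB (w 0 - μ 0) * wtB (v 0 - μ 0))
      * (∏ k : Fin n, wtB (w 0 - w k.succ) ^ 2 * wtB (v 0 - v k.succ) ^ 2)
      * (∏ k : Fin n, wtA γ (w k.succ - μ 0) * wtA γ (v k.succ - μ 0))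
      * (Ffac γ μ w v)⁻¹ * Lfac γ h μ w v 0 := by
  rw [Hker, Hker, neg_one_pow_succ_mul_succ]
  simp only [Fin.prod_univ_succ, Fin.prod_Ioi_zero, Fin.prod_Ioi_succ, Fin.castLE_zero,
    Fin.castLE_succ, Rfac_zero, Rfac_succ, Lfac_succ, mul_assoc (_ ^ 2 * _ ^ 2),
    Finset.prod_mul_distrib (f := fun k : Fin n => wtB (w 0 - w k.succ) ^ 2 * _)]
  rw [mul_add, pow_add]
  ring

lemma Hker_eq_Hbar_mul
    (hμ : ∀ k : Fin L, wtA γ (μ 0 - μ k.succ) ≠ 0 ∧ wtA γ (μ k.succ - μ 0) ≠ 0) :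
    Hker γ h μ w v =
      Hbar γ (Nat.le_of_succ_le_succ h) μ (fun k => w k.succ) (fun k => v k.succ)
        / (wtB (w 0 - μ 0) * wtB (v 0 - μ 0))
      * (∏ k : Fin n, wtB (w 0 - w k.succ) ^ 2 * wtB (v 0 - v k.succ) ^ 2)
      * ((∏ k : Fin n, wtA γ (w k.succ - μ 0) * wtA γ (v k.succ - μ 0))
          / ∏ k : Fin L, wtA γ (μ 0 - μ k.succ) * wtA γ (μ k.succ - μ 0))
      * (Ffac γ μ w v)⁻¹ * Lfac γ h μ w v 0 := by
  have hP : (∏ k : Fin L, wtA γ (μ 0 - μ k.succ) * wtA γ (μ k.succ - μ 0)) ≠ 0 :=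
    Finset.prod_ne_zero_iff.2 fun k _ => mul_ne_zero (hμ k).1 (hμ k).2
  rw [Hker_succ, Hbar, recConst]
  field_simp

end kernelRecursion

lemma Hker_one (γ : ℂ) {L : ℕ} (h : 1 ≤ L + 1) (μ : Fin (L + 1) → ℂ) (w v : ℂ) :
    Hker γ h μ ![w] ![v] =
      wtC γ ^ 2 * ((∏ k, wtA γ (w - μ k) * wtB (v - μ k)) - ∏ k, wtA γ (v - μ k) * wtB (w - μ k))
        / (wtB (w - μ 0) * wtB (v - μ 0)
          * (wtA γ (w - μ 0) / wtB (w - μ 0) - wtA γ (v - μ 0) / wtB (v - μ 0))) := by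
  have hreflect (x y : ℂ) : ∏ k, wtA γ (x - μ k) * wtB (μ k - y) =
      -(-1) ^ L * ∏ k, wtA γ (x - μ k) * wtB (y - μ k) := by
    have hsq : (-1 : ℂ) ^ (L + 1) * (-1) ^ (L + 1) = 1 := by rw [← mul_pow]; simp
    simp only [Finset.prod_mul_distrib, prod_wtB_sub_comm y, Fintype.card_fin]
    linear_combination (-(∏ k, wtA γ (x - μ k)) * ∏ k, wtB (μ k - y)) * hsq
  have hsign : (-1 : ℂ) ^ L * (-1) ^ L = 1 := by rw [← mul_pow]; simp
  rw [Hker_succ, Lfac_zero]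
  simp only [Ffac, Hker, Matrix.cons_val_fin_one, Finset.univ_eq_empty, Finset.prod_empty,
    Finset.prod_const, Finset.card_empty, Finset.card_univ, Fintype.card_fin, hreflect,
    mul_zero, zero_add, Nat.zero_div, pow_zero, pow_one, div_one, mul_one]
  rw [div_mul_eq_div_div (wtC γ ^ 2 * _) (wtB (w - μ 0) * _)]
  linear_combination (wtC γ ^ 2 / (wtB (w - μ 0) * wtB (v - μ 0)) /
    (wtA γ (w - μ 0) / wtB (w - μ 0) - wtA γ (v - μ 0) / wtB (v - μ 0)) *
    ((∏ k, wtA γ (w - μ k) * wtB (v - μ k)) - ∏ k, wtA γ (v - μ k) * wtB (w - μ k))) * hsign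

open Filter Topology

/-! ### Generic position -/

section density
variable {E : Type*} [NormedAddCommGroup E] [NormedSpace ℂ E]

lemma eventually_residual_ne_zero {f : E → ℂ} (hf : AnalyticOnNhd ℂ f univ) (h : ∃ x, f x ≠ 0) :
    ∀ᶠ x in residual E, f x ≠ 0 := by
  obtain ⟨x, hx⟩ := h
  refine residual_of_dense_open (isOpen_ne_fun ?_ continuous_const) (dense_ne_zero hf hx)
  exact continuousOn_univ.1 hf.continuousOn

lemma eventually_residual_wtB_sub {ι : Type*} [Finite ι] {f : ι → E → ℂ}
    (hf : ∀ j, AnalyticOnNhd ℂ (f j) univ) (h : ∀ j k, j ≠ k → ∃ x, wtB (f j x - f k x) ≠ 0) :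
    ∀ᶠ x in residual E, ∀ j k, wtB (f j x - f k x) = 0 → j = k := by
  have hne : ∀ᶠ x in residual E, ∀ j k, j ≠ k → wtB (f j x - f k x) ≠ 0 :=
    eventually_all.2 fun j => eventually_all.2 fun k => eventually_imp_distrib_left.2 fun hjk =>
      eventually_residual_ne_zero
        (fun x _ => analyticAt_wtB_sub (hf j x trivial) (hf k x trivial)) (h j k hjk)
  exact hne.mono fun x hx j k h0 => not_imp_comm.1 (hx j k) (not_not.2 h0)

end density

lemma wtB_one_ne_zero : wtB 1 ≠ 0 := by
  rw [wtB, ← Complex.ofReal_one, ← Complex.ofReal_sinh, Complex.ofReal_ne_zero]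
  exact (Real.sinh_pos_iff.2 one_pos).ne'

lemma wtB_single_sub_single_ne_zero {n : ℕ} {j k : Fin n} (hjk : j ≠ k) :
    wtB ((Pi.single j 1 : Fin n → ℂ) j - (Pi.single j 1 : Fin n → ℂ) k) ≠ 0 := by
  simpa [hjk.symm] using wtB_one_ne_zero

lemma eventually_residual_wtB_fst_sub {n : ℕ} :
    ∀ᶠ p : (Fin n → ℂ) × (Fin n → ℂ) in residual _, ∀ j k, wtB (p.1 j - p.1 k) = 0 → j = k :=
  eventually_residual_wtB_sub (fun j x _ => analyticAt_fst_apply j x) fun j _ hjk =>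
    ⟨(Pi.single j 1, 0), wtB_single_sub_single_ne_zero hjk⟩

lemma eventually_residual_wtB_snd_sub {n : ℕ} :
    ∀ᶠ p : (Fin n → ℂ) × (Fin n → ℂ) in residual _, ∀ j k, wtB (p.2 j - p.2 k) = 0 → j = k :=
  eventually_residual_wtB_sub (fun j x _ => analyticAt_snd_apply j x) fun j _ hjk =>
    ⟨(0, Pi.single j 1), wtB_single_sub_single_ne_zero hjk⟩

section generic
variable {γ : ℂ} {L n : ℕ} (h : n ≤ L) (μ : Fin L → ℂ)

lemma eventually_residual_Rnum (hc : wtC γ ≠ 0) :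
    ∀ᶠ p : (Fin n → ℂ) × (Fin n → ℂ) in residual _, ∀ (f g : Fin n → Fin n) (i : Fin n),
      Rnum γ h μ (p.1 ∘ f) (p.2 ∘ g) i ≠ 0 := by
  refine eventually_all.2 fun f => eventually_all.2 fun g => eventually_all.2 fun i =>
    eventually_residual_ne_zero (fun x _ => analyticAt_Rnum (fun k => analyticAt_fst_apply (f k) x)
      (fun k => analyticAt_snd_apply (g k) x) i)
      ⟨(fun _ => 1 + μ (Fin.castLE h i), fun _ => μ (Fin.castLE h i)), ?_⟩
  have hcard : (Finset.Ici i).card ≠ 0 := Finset.card_ne_zero.2 ⟨i, Finset.mem_Ici.2 le_rfl⟩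
  simp only [Rnum, Function.comp_apply, sub_self, add_sub_cancel_right, wtB_zero, wtA_zero,
    mul_zero, Finset.prod_const, zero_pow hcard, zero_sub]
  exact neg_ne_zero.2 (pow_ne_zero _ (mul_ne_zero hc wtB_one_ne_zero))

lemma dense_generic (hc : wtC γ ≠ 0) :
    Dense {p : (Fin n → ℂ) × (Fin n → ℂ) | Generic γ h μ p.1 p.2} := by
  refine dense_of_mem_residual ?_
  filter_upwards [eventually_residual_wtB_fst_sub, eventually_residual_wtB_snd_sub,
    eventually_residual_Rnum h μ hc] with p hC hB hR
  exact ⟨fun j k h0 => congrArg p.1 (hC j k h0), fun j k h0 => congrArg p.2 (hB j k h0), hR⟩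

end generic

/-! ### Existence of contours -/

/-- The contour made of the circles of radius `r` around the points of `S`. -/
def Contour.circles (S : Finset ℂ) (r : ℝ) (hr : 0 < r)
    (hd : ∀ x ∈ S, ∀ y ∈ S, x ≠ y → 2 * r < dist x y) : Contour where
  m := S.card
  center j := S.equivFin.symm j
  radius _ := r
  radius_pos _ := hr
  disjoint j k hjk := by
    refine Metric.closedBall_disjoint_closedBall ?_
    rw [← two_mul]
    exact hd _ (Subtype.coe_prop _) _ (Subtype.coe_prop _)
      (Subtype.coe_injective.ne (S.equivFin.symm.injective.ne hjk))

section circles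
variable {S : Finset ℂ} {r : ℝ} {hr : 0 < r} {hd : ∀ x ∈ S, ∀ y ∈ S, x ≠ y → 2 * r < dist x y}

lemma iUnion_equivFin_symm {α β : Type*} (S : Finset α) (t : α → Set β) :
    ⋃ j, t (S.equivFin.symm j : α) = ⋃ x ∈ S, t x :=
  (S.equivFin.symm.surjective.iUnion_comp fun x : S => t x).trans (iUnion_subtype (· ∈ S) _)

lemma Contour.trace_circles : (circles S r hr hd).trace = ⋃ x ∈ S, Metric.sphere x r :=
  iUnion_equivFin_symm S fun x => Metric.sphere x r

lemma Contour.inside_circles : (circles S r hr hd).inside = ⋃ x ∈ S, Metric.ball x r :=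
  iUnion_equivFin_symm S fun x => Metric.ball x r

lemma Contour.filled_circles : (circles S r hr hd).filled = ⋃ x ∈ S, Metric.closedBall x r :=
  iUnion_equivFin_symm S fun x => Metric.closedBall x r

end circles

lemma eventually_forall_closedBall {X : Type*} [PseudoMetricSpace X] {x : X} {P : X → Prop}
    (hP : ∀ᶠ y in 𝓝 x, P y) : ∀ᶠ r in 𝓝[>] (0 : ℝ), ∀ y ∈ Metric.closedBall x r, P y := by
  obtain ⟨ε, hε, hb⟩ := Metric.nhds_basis_closedBall.eventually_iff.1 hP
  filter_upwards [Ioo_mem_nhdsGT hε] with r hr y hy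
  exact hb (Metric.closedBall_subset_closedBall hr.2.le hy)

lemma eventually_wtB_sub_ne_zero (z y : ℂ) : ∀ᶠ x in 𝓝[≠] z, wtB (x - y) ≠ 0 := by
  have hd : HasDerivAt (fun x => wtB (x - y)) (Complex.cosh (z - y)) z := by
    simpa [wtB] using ((hasDerivAt_id z).sub_const y).csinh
  by_cases h0 : wtB (z - y) = 0
  · refine hd.eventually_ne fun hcosh => ?_
    have hsq := Complex.cosh_sq_sub_sinh_sq (z - y)
    rw [wtB] at h0
    simp [h0, hcosh] at hsq
  · exact (hd.continuousAt.eventually_ne h0).filter_mono nhdsWithin_le_nhds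

lemma eventually_wtB_sub_eq_zero_imp {x y : ℂ} (hxy : wtB (x - y) = 0 → x = y) :
    ∀ᶠ z in 𝓝 x, wtB (z - y) = 0 → z = y := by
  have h0 : sinhDiv (x - y) ≠ 0 := sinhDiv_ne_zero_iff.2 fun h => sub_eq_zero.2 (hxy h)
  have hcont : ContinuousAt (fun z => sinhDiv (z - y)) x :=
    (differentiable_sinhDiv.continuous.comp (continuous_id.sub continuous_const)).continuousAt
  filter_upwards [hcont.eventually_ne h0] with z hz hz0
  exact sub_eq_zero.1 (sinhDiv_ne_zero_iff.1 hz hz0)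

/-- A contour for one of the variables: it encloses the points `c j` and no other zero of any
`b(z - c j)`, avoids the zeros of all `b(z - μ i)`, and stays within distance `r` of the `c j`. -/
structure Contour.IsTight (Γ : Contour) {n L : ℕ} (c : Fin n → ℂ) (μ : Fin L → ℂ) (r : ℝ) :
    Prop where
  mem_inside : ∀ j, c j ∈ Γ.inside
  eq_of_wtB_eq_zero : ∀ z ∈ Γ.filled, ∀ j, wtB (z - c j) = 0 → z = c j
  wtB_ne_zero : ∀ z ∈ Γ.trace, ∀ i, wtB (z - μ i) ≠ 0
  exists_mem_closedBall : ∀ z ∈ Γ.filled, ∃ j, z ∈ Metric.closedBall (c j) r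

lemma eventually_exists_isTight {n : ℕ} {c : Fin n → ℂ}
    (hc : ∀ j k, wtB (c j - c k) = 0 → c j = c k) {L : ℕ} (μ : Fin L → ℂ) :
    ∀ᶠ r in 𝓝[>] (0 : ℝ), ∃ Γ : Contour, Γ.IsTight c μ r := by
  have hdist : ∀ᶠ r in 𝓝[>] (0 : ℝ), ∀ j k, c j ≠ c k → 2 * r < dist (c j) (c k) := by
    refine eventually_all.2 fun j => eventually_all.2 fun k =>
      eventually_imp_distrib_left.2 fun hjk => ?_
    filter_upwards [Ioo_mem_nhdsGT (half_pos (dist_pos.2 hjk))] with r hr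
    linarith [hr.2]
  have hzero : ∀ᶠ r in 𝓝[>] (0 : ℝ), ∀ j k, ∀ z ∈ Metric.closedBall (c j) r,
      wtB (z - c k) = 0 → z = c k :=
    eventually_all.2 fun j => eventually_all.2 fun k =>
      eventually_forall_closedBall (eventually_wtB_sub_eq_zero_imp (hc j k))
  have hμ : ∀ᶠ r in 𝓝[>] (0 : ℝ), ∀ j i, ∀ z ∈ Metric.closedBall (c j) r,
      z ≠ c j → wtB (z - μ i) ≠ 0 :=
    eventually_all.2 fun j => eventually_all.2 fun i => eventually_forall_closedBall
      (eventually_nhdsWithin_iff.1 (eventually_wtB_sub_ne_zero (c j) (μ i)))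
  filter_upwards [hdist, hzero, hμ, self_mem_nhdsWithin] with r hdist hzero hμ (hr : 0 < r)
  have hd : ∀ x ∈ Finset.univ.image c, ∀ y ∈ Finset.univ.image c, x ≠ y → 2 * r < dist x y := by
    simpa [Finset.mem_image] using hdist
  refine ⟨.circles _ r hr hd, ?_, ?_, ?_, ?_⟩
  · exact fun j => Contour.inside_circles ▸ by simpa using ⟨j, Metric.mem_ball_self hr⟩
  all_goals simp only [Contour.filled_circles, Contour.trace_circles,
    Finset.set_biUnion_finset_image, Finset.mem_univ, iUnion_true, mem_iUnion]
  · exact fun z ⟨j, hj⟩ k => hzero j k z hj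
  · exact fun z ⟨j, hj⟩ i => hμ j i z (Metric.sphere_subset_closedBall hj)
      (Metric.ne_of_mem_sphere hj hr.ne')
  · exact fun z hz => hz

section admissible
variable {γ : ℂ} {L n : ℕ} {h : n ≤ L} {μ : Fin L → ℂ} {lamC lamB : Fin n → ℂ}

lemma Contour.IsTight.admissible {Γ Δ : Contour} {r : ℝ} (hΓ : Γ.IsTight lamC μ r)
    (hΔ : Δ.IsTight lamB μ r)
    (hR : ∀ w v : Fin n → ℂ, (∀ i, ∃ j, w i ∈ Metric.closedBall (lamC j) r) →
      (∀ i, ∃ j, v i ∈ Metric.closedBall (lamB j) r) → ∀ i, Rnum γ h μ w v i ≠ 0) :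
    Admissible γ h μ lamC lamB (fun _ => Γ) (fun _ => Δ) where
  mem_C _ := hΓ.mem_inside
  mem_B _ := hΔ.mem_inside
  only_C _ := hΓ.eq_of_wtB_eq_zero
  only_B _ := hΔ.eq_of_wtB_eq_zero
  on_contour w v hw hv := denomsNonzero_of_Rnum_ne_zero
    (fun _ k _ => ⟨hΓ.wtB_ne_zero _ (hw k) _, hΔ.wtB_ne_zero _ (hv k) _⟩)
    (hR w v (fun i => hΓ.exists_mem_closedBall _ (Γ.trace_subset_filled (hw i)))
      fun i => hΔ.exists_mem_closedBall _ (Δ.trace_subset_filled (hv i)))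
  holomorphic := by
    refine ⟨fun p => Hnum γ h μ p.1 p.2 / ∏ i, Rnum γ h μ p.1 p.2 i, fun p hp => ?_,
      fun w v _ _ hD _ => (Hker_eq_div_of_denomsNonzero hD).symm⟩
    have hfst := fun k => analyticAt_fst_apply k p
    have hsnd := fun k => analyticAt_snd_apply k p
    exact (analyticAt_Hnum hfst hsnd).fun_div
      (Finset.analyticAt_fun_prod _ fun i _ => analyticAt_Rnum hfst hsnd i)
      (Finset.prod_ne_zero_iff.2 fun i _ =>
        hR p.1 p.2 (fun k => hΓ.exists_mem_closedBall _ (hp.1 k))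
          (fun k => hΔ.exists_mem_closedBall _ (hp.2 k)) i)

lemma Generic.eventually_Rnum_ne_zero (hG : Generic γ h μ lamC lamB) :
    ∀ᶠ r in 𝓝[>] (0 : ℝ), ∀ w v : Fin n → ℂ,
      (∀ i, ∃ j, w i ∈ Metric.closedBall (lamC j) r) →
      (∀ i, ∃ j, v i ∈ Metric.closedBall (lamB j) r) → ∀ i, Rnum γ h μ w v i ≠ 0 := by
  have hR : ∀ᶠ r in 𝓝[>] (0 : ℝ), ∀ (f g : Fin n → Fin n) (i : Fin n),
      ∀ p ∈ Metric.closedBall (lamC ∘ f, lamB ∘ g) r, Rnum γ h μ p.1 p.2 i ≠ 0 := by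
    refine eventually_all.2 fun f => eventually_all.2 fun g => eventually_all.2 fun i =>
      eventually_forall_closedBall ?_
    exact ((analyticAt_Rnum (fun k => analyticAt_fst_apply k _)
      (fun k => analyticAt_snd_apply k _) i).continuousAt).eventually_ne (hG.2.2 f g i)
  filter_upwards [hR, self_mem_nhdsWithin] with r hR (hr : 0 < r) w v hw hv i
  choose f hf using hw
  choose g hg using hv
  refine hR f g i (w, v) ?_
  rw [Metric.mem_closedBall, Prod.dist_eq, max_le_iff]
  exact ⟨(dist_pi_le_iff hr.le).2 hf, (dist_pi_le_iff hr.le).2 hg⟩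

lemma Generic.exists_admissible (hG : Generic γ h μ lamC lamB) :
    ∃ Γ Δ : Fin n → Contour, Admissible γ h μ lamC lamB Γ Δ := by
  obtain ⟨r, ⟨Γ, hΓ⟩, ⟨Δ, hΔ⟩, hR⟩ := (((eventually_exists_isTight hG.1 μ).and
    ((eventually_exists_isTight hG.2.1 μ).and hG.eventually_Rnum_ne_zero))).exists
  exact ⟨_, _, hΓ.admissible hΔ hR⟩

end admissible

/-! ### The scalar product as a sum over residues -/

section continuity
variable {γ : ℂ} {L n : ℕ}

lemma continuous_prodBlock (γ : ℂ) (a b : Fin 2) :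
    Continuous fun p : (Fin L → ℂ) × (Fin n → ℂ) => prodBlock γ p.1 a b p.2 := by
  simp only [prodBlock, List.ofFn_eq_map]
  exact continuous_list_prod _ fun i _ =>
    (continuous_block γ a b).comp (f := fun p : (Fin L → ℂ) × (Fin n → ℂ) => (p.1, p.2 i))
      (by fun_prop)

lemma continuous_scalarProduct {T : Type*} [TopologicalSpace T] {μ : T → Fin L → ℂ}
    {X Y : T → Fin n → ℂ} (hμ : Continuous μ) (hX : Continuous X) (hY : Continuous Y) :
    Continuous fun t => scalarProduct γ (μ t) (X t) (Y t) := by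
  simp only [scalarProduct_eq]
  have hprod (a b : Fin 2) {Z : T → Fin n → ℂ} (hZ : Continuous Z) :
      Continuous fun t => prodBlock γ (μ t) a b (Z t) :=
    (continuous_prodBlock γ a b).comp (f := fun t => (μ t, Z t)) (hμ.prodMk hZ)
  exact ((hprod 1 0 hX).mul (hprod 0 1 hY)).matrix_elem _ _

lemma dense_inhomogeneities (γ x₀ : ℂ) (L : ℕ) :
    Dense {μ : Fin L → ℂ | ∀ k, wtA γ (x₀ - μ k) ≠ 0 ∧ wtA γ (μ k - x₀) ≠ 0} := by
  obtain ⟨x, hx⟩ := (dense_wtA_sub_ne_zero γ 0).nonempty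
  have hx : wtA γ x ≠ 0 := by simpa using hx
  have analyticAt_apply (k : Fin L) (μ : Fin L → ℂ) : AnalyticAt ℂ (fun ν : Fin L → ℂ => ν k) μ :=
    (ContinuousLinearMap.proj (R := ℂ) (φ := fun _ : Fin L => ℂ) k).analyticAt μ
  refine dense_of_mem_residual (eventually_all.2 fun k => .and ?_ ?_)
  · exact eventually_residual_ne_zero
      (fun μ _ => analyticAt_wtA_sub γ analyticAt_const (analyticAt_apply k μ))
      ⟨fun _ => x₀ - x, by simpa using hx⟩
  · exact eventually_residual_ne_zero
      (fun μ _ => analyticAt_wtA_sub γ (analyticAt_apply k μ) analyticAt_const)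
      ⟨fun _ => x + x₀, by simpa using hx⟩

lemma continuous_Omega_inhomogeneities (x₀ : ℂ) (X Y : Fin n → ℂ) (i j : Fin n) :
    Continuous fun μ : Fin L → ℂ => Omega γ (Fin.cons x₀ μ : Fin (L + 1) → ℂ) X Y i j := by
  have hA (x : ℂ) : Continuous fun μ : Fin L → ℂ => ∏ k, wtA γ (x - μ k) :=
    continuous_finsetProd _ fun k _ =>
      (continuous_wtA γ).comp (continuous_const.sub (continuous_apply k))
  have hB (x : ℂ) : Continuous fun μ : Fin L → ℂ => ∏ k, wtB (μ k - x) :=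
    continuous_finsetProd _ fun k _ =>
      continuous_wtB.comp ((continuous_apply k).sub continuous_const)
  simp only [Omega, Fin.cons_zero, Fin.cons_succ, Finset.prod_mul_distrib, Fin.prod_univ_succ]
  refine continuous_const.mul (.sub ?_ ?_) <;>
  exact (((continuous_const.mul (hA _)).mul (continuous_const.mul (hB _))).mul
    continuous_const).mul continuous_const

end continuity

section cancelledRecursion
variable {γ : ℂ} {L n : ℕ} {μ : Fin (L + 1) → ℂ} {X Y : Fin (n + 1) → ℂ}

lemma Kfac_mul_recConst
    (hμ : ∀ k : Fin L, wtA γ (μ 0 - μ k.succ) ≠ 0 ∧ wtA γ (μ k.succ - μ 0) ≠ 0) :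
    Kfac γ μ X Y * recConst γ μ =
      (∏ k, wtA γ (X k - μ 0) * wtA γ (Y k - μ 0)) * (Ffac γ μ X Y)⁻¹ *
        ((-1) ^ L * wtC γ ^ 2) := by
  have hP := Finset.prod_ne_zero_iff.2 fun k (_ : k ∈ Finset.univ) => mul_ne_zero (hμ k).1 (hμ k).2
  rw [Kfac, recConst]
  generalize (Ffac γ μ X Y)⁻¹ = F
  field_simp

/-- The denominators `a(μ₁ - μ_k) a(μ_k - μ₁)` cancel from the recursion, which therefore persists,
by continuity in `μ₂, …, μ_L`, at their zeros. -/
lemma scalarProduct_recursion_cancelled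
    (hX₀ : ∀ i, wtA γ (X i - μ 0) ≠ 0 ∧ wtB (X i - μ 0) ≠ 0)
    (hY₀ : ∀ i, wtA γ (Y i - μ 0) ≠ 0 ∧ wtB (Y i - μ 0) ≠ 0)
    (hX : ∀ i k, i ≠ k → wtB (X i - X k) ≠ 0) (hY : ∀ i k, i ≠ k → wtB (Y i - Y k) ≠ 0)
    (hF : Ffac γ μ X Y ≠ 0) :
    scalarProduct γ μ X Y = (∏ k, wtA γ (X k - μ 0) * wtA γ (Y k - μ 0)) * (Ffac γ μ X Y)⁻¹ *
      ((-1) ^ L * wtC γ ^ 2) * ∑ i, ∑ j, Omega γ μ X Y i j *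
        scalarProduct γ (fun k => μ k.succ) (fun k => X (i.succAbove k))
          (fun k => Y (j.succAbove k)) := by
  have key : (fun ν : Fin L → ℂ => scalarProduct γ (Fin.cons (μ 0) ν : Fin (L + 1) → ℂ) X Y) =
      fun ν => (∏ k, wtA γ (X k - μ 0) * wtA γ (Y k - μ 0)) * (Ffac γ μ X Y)⁻¹ *
        ((-1) ^ L * wtC γ ^ 2) * ∑ i, ∑ j, Omega γ (Fin.cons (μ 0) ν : Fin (L + 1) → ℂ) X Y i j *
          scalarProduct γ ν (fun k => X (i.succAbove k)) (fun k => Y (j.succAbove k)) := by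
    refine Continuous.ext_on (dense_inhomogeneities γ (μ 0) L)
      (continuous_scalarProduct (continuous_const.finCons continuous_id) continuous_const
        continuous_const)
      (continuous_const.mul (continuous_finsetSum _ fun i _ => continuous_finsetSum _ fun j _ =>
        (continuous_Omega_inhomogeneities _ _ _ _ _).mul
          (continuous_scalarProduct continuous_id continuous_const continuous_const)))
      fun ν hν => ?_
    have hν : ∀ k, wtA γ (μ 0 - ν k) ≠ 0 ∧ wtA γ (ν k - μ 0) ≠ 0 := hν
    have hK : Kfac γ (Fin.cons (μ 0) ν : Fin (L + 1) → ℂ) X Y * recConst γ (Fin.cons (μ 0) ν) =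
        (∏ k, wtA γ (X k - μ 0) * wtA γ (Y k - μ 0)) * (Ffac γ μ X Y)⁻¹ *
          ((-1) ^ L * wtC γ ^ 2) := Kfac_mul_recConst hν
    rw [scalarProduct_recursion X Y (μ := Fin.cons (μ 0) ν) hν hX₀ hY₀ hX hY hF, ← hK]
    simp only [Vfun, Fin.cons_succ, Finset.mul_sum]
    exact Finset.sum_congr rfl fun i _ => Finset.sum_congr rfl fun j _ => by ring
  have := congrFun key (Fin.tail μ)
  rw [Fin.cons_self_tail] at this
  exact this

end cancelledRecursion

section consSuccAbove
variable {n : ℕ}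

/-- The selection of `n + 1` indices which starts with `i` and continues with the selection `f`
among the indices other than `i`. -/
def consSuccAbove (i : Fin (n + 1)) (f : Fin n → Fin n) : Fin (n + 1) → Fin (n + 1) :=
  Fin.cons i (i.succAbove ∘ f)

@[simp]
lemma consSuccAbove_zero (i : Fin (n + 1)) (f : Fin n → Fin n) : consSuccAbove i f 0 = i :=
  rfl

@[simp]
lemma consSuccAbove_succ (i : Fin (n + 1)) (f : Fin n → Fin n) (k : Fin n) :
    consSuccAbove i f k.succ = i.succAbove (f k) :=
  rfl

lemma sum_eq_sum_consSuccAbove {M : Type*} [AddCommMonoid M]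
    {T : (Fin (n + 1) → Fin (n + 1)) → M} (hT : ∀ f, ¬ Function.Injective f → T f = 0) :
    ∑ f, T f = ∑ i, ∑ f : Fin n → Fin n, T (consSuccAbove i f) := by
  rw [sum_pi_fin_succ]
  refine Finset.sum_congr rfl fun i _ => (Fintype.sum_of_injective (i.succAbove ∘ ·)
    Fin.succAbove_right_injective.comp_left _ _ (fun f hf => hT _ fun hinj => hf ?_)
    fun f => rfl).symm
  choose f' hf' using fun k => Fin.exists_succAbove_eq
    (hinj.ne (Fin.succ_ne_zero k) : (Fin.cons i f : Fin (n + 1) → Fin (n + 1)) k.succ ≠ _)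
  exact ⟨f', funext hf'⟩

variable {M : Type*} [CommMonoid M]

lemma prod_succAbove_comp {f : Fin n → Fin n} (hf : Function.Injective f) (i : Fin (n + 1))
    (F : Fin (n + 1) → M) : ∏ k, F (i.succAbove (f k)) = ∏ k ∈ Finset.univ.erase i, F k := by
  rw [prod_erase_eq_prod_succAbove]
  exact (Finite.injective_iff_bijective.1 hf).prod_comp fun k => F (i.succAbove k)

lemma prod_consSuccAbove {f : Fin n → Fin n} (hf : Function.Injective f) (i : Fin (n + 1))
    (F : Fin (n + 1) → M) : ∏ k, F (consSuccAbove i f k) = ∏ k, F k := by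
  simp only [Fin.prod_univ_succ fun k => F (consSuccAbove i f k), consSuccAbove_zero,
    consSuccAbove_succ, prod_succAbove_comp hf, Finset.mul_prod_erase _ _ (Finset.mem_univ i)]

lemma prod_erase_succAbove (i : Fin (n + 1)) (m : Fin n) (F : Fin (n + 1) → M) :
    ∏ k ∈ Finset.univ.erase (i.succAbove m), F k =
      F i * ∏ k ∈ Finset.univ.erase m, F (i.succAbove k) := by
  have herase : Finset.univ.erase (i.succAbove m) =
      insert i ((Finset.univ.erase m).map i.succAboveEmb) := by
    rw [Finset.map_erase, Fin.coe_succAboveEmb,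
      ← Finset.erase_insert_of_ne (Fin.succAbove_ne i m).symm,
      ← Finset.cons_eq_insert _ _ (by simp [Fin.succAbove_ne]), ← Fin.univ_succAbove]
  rw [herase, Finset.prod_insert (by simp [Fin.succAbove_ne]), Finset.prod_map]
  rfl

lemma residueDenom_consSuccAbove {f : Fin n → Fin n} (hf : Function.Injective f) (i : Fin (n + 1))
    (c : Fin (n + 1) → ℂ) :
    residueDenom c (consSuccAbove i f) = (-1) ^ n *
      (∏ k ∈ Finset.univ.erase i, wtB (c i - c k)) ^ 2 *
        residueDenom (fun k => c (i.succAbove k)) f := by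
  have hflip : ∏ k, wtB (c (i.succAbove (f k)) - c i) =
      (-1) ^ n * ∏ k, wtB (c i - c (i.succAbove (f k))) := by
    simp only [← neg_sub (c i), wtB_neg, Finset.prod_neg, Finset.card_univ, Fintype.card_fin]
  rw [residueDenom_succ]
  simp only [consSuccAbove_zero, consSuccAbove_succ, residueDenom,
    prod_erase_succAbove, Finset.prod_mul_distrib, hflip,
    prod_succAbove_comp hf i fun k => wtB (c i - c k)]
  ring

end consSuccAbove

section residueExpansion
variable {γ : ℂ} {L n : ℕ}

/-- A condition on `X, Y` which excludes the zeros of all denominators in the recursion for the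
scalar product, at each of its steps, and which allows the kernel to be evaluated at all
tuples of entries of `X` and of `Y`. -/
structure Regular (γ : ℂ) {L n : ℕ} (h : n ≤ L) (μ : Fin L → ℂ) (X Y : Fin n → ℂ) : Prop where
  wtB_left : ∀ j k, wtB (X j - X k) = 0 → j = k
  wtB_right : ∀ j k, wtB (Y j - Y k) = 0 → j = k
  wt_left : ∀ i k, wtA γ (X k - μ (Fin.castLE h i)) ≠ 0 ∧ wtB (X k - μ (Fin.castLE h i)) ≠ 0
  wt_right : ∀ i k, wtA γ (Y k - μ (Fin.castLE h i)) ≠ 0 ∧ wtB (Y k - μ (Fin.castLE h i)) ≠ 0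
  denomsNonzero : ∀ f g : Fin n → Fin n, DenomsNonzero γ h μ (X ∘ f) (Y ∘ g)

lemma Hker_comp_eq_zero {m : ℕ} {h : n ≤ L} {μ : Fin L → ℂ} {X Y : Fin m → ℂ} {f g : Fin n → Fin m}
    (hfg : ¬ Function.Injective f ∨ ¬ Function.Injective g) :
    Hker γ h μ (X ∘ f) (Y ∘ g) = 0 := by
  have hpair {e : Fin n → Fin m} (he : ¬ Function.Injective e) : ∃ i k, i < k ∧ e i = e k := by
    obtain ⟨i, k, hik, hne⟩ := Function.not_injective_iff.1 he
    exact hne.lt_or_gt.elim (fun h => ⟨i, k, h, hik⟩) fun h => ⟨k, i, h, hik.symm⟩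
  rcases hfg with hf | hg
  · obtain ⟨i, k, hik, heq⟩ := hpair hf
    exact Hker_eq_zero hik (.inl (by simp [heq, wtB_zero]))
  · obtain ⟨i, k, hik, heq⟩ := hpair hg
    exact Hker_eq_zero hik (.inr (by simp [heq, wtB_zero]))

variable {h : n + 1 ≤ L + 1} {μ : Fin (L + 1) → ℂ} {X Y : Fin (n + 1) → ℂ}

lemma Regular.succAbove (hG : Regular γ h μ X Y) (i j : Fin (n + 1)) :
    Regular γ (Nat.le_of_succ_le_succ h) (fun k => μ k.succ) (fun k => X (i.succAbove k))
      (fun k => Y (j.succAbove k)) where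
  wtB_left k l h0 := Fin.succAbove_right_injective (p := i) (hG.wtB_left _ _ h0)
  wtB_right k l h0 := Fin.succAbove_right_injective (p := j) (hG.wtB_right _ _ h0)
  wt_left l k := hG.wt_left l.succ (i.succAbove k)
  wt_right l k := hG.wt_right l.succ (j.succAbove k)
  denomsNonzero f g := by
    have hD := hG.denomsNonzero (consSuccAbove i f) (consSuccAbove j g)
    refine ⟨fun l k hlk => hD.1 l.succ k.succ (Fin.succ_le_succ_iff.2 hlk), fun l => ?_⟩
    have hR := hD.2 l.succ
    rw [Rfac_succ] at hR
    exact hR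

lemma Regular.Ffac_ne_zero (hG : Regular γ h μ X Y) : Ffac γ μ X Y ≠ 0 :=
  Rfac_zero γ h μ X Y ▸ (hG.denomsNonzero id id).2 0

lemma Ffac_consSuccAbove {f g : Fin n → Fin n} (hf : Function.Injective f)
    (hg : Function.Injective g) (i j : Fin (n + 1)) :
    Ffac γ μ (X ∘ consSuccAbove i f) (Y ∘ consSuccAbove j g) = Ffac γ μ X Y := by
  simp only [Ffac, Function.comp_apply,
    prod_consSuccAbove hf i fun k => wtA γ (X k - μ 0) / wtB (X k - μ 0),
    prod_consSuccAbove hg j fun k => wtA γ (Y k - μ 0) / wtB (Y k - μ 0)]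

lemma Omega_eq_div_mul_Lfac {f g : Fin n → Fin n} (hf : Function.Injective f)
    (hg : Function.Injective g) (i j : Fin (n + 1)) :
    Omega γ μ X Y i j =
      1 / (wtA γ (X i - μ 0) * wtB (X i - μ 0) * wtA γ (Y j - μ 0) * wtB (Y j - μ 0)) *
        Lfac γ h μ (X ∘ consSuccAbove i f) (Y ∘ consSuccAbove j g) 0 := by
  simp only [Omega, Lfac_zero, Function.comp_apply, consSuccAbove_zero, consSuccAbove_succ,
    prod_succAbove_comp hf i fun k => wtA γ (X i - X k) / wtB (X i - X k),
    prod_succAbove_comp hf i fun k => wtA γ (X k - X i) / wtB (X k - X i),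
    prod_succAbove_comp hg j fun k => wtA γ (Y j - Y k) / wtB (Y j - Y k),
    prod_succAbove_comp hg j fun k => wtA γ (Y k - Y j) / wtB (Y k - Y j)]

/-- The recursions for the scalar product and for the kernel agree term by term. -/
lemma Hker_consSuccAbove_div_residueDenom (hG : Regular γ h μ X Y) {f g : Fin n → Fin n}
    (hf : Function.Injective f) (hg : Function.Injective g) (i j : Fin (n + 1)) :
    Hker γ h μ (X ∘ consSuccAbove i f) (Y ∘ consSuccAbove j g) /
        residueDenom X (consSuccAbove i f) / residueDenom Y (consSuccAbove j g) =
      (∏ k, wtA γ (X k - μ 0) * wtA γ (Y k - μ 0)) * (Ffac γ μ X Y)⁻¹ * ((-1) ^ L * wtC γ ^ 2) *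
        (Omega γ μ X Y i j *
          (Hker γ (Nat.le_of_succ_le_succ h) (fun k => μ k.succ) (fun k => X (i.succAbove (f k)))
              (fun k => Y (j.succAbove (g k))) /
            residueDenom (fun k => X (i.succAbove k)) f /
              residueDenom (fun k => Y (j.succAbove k)) g)) := by
  have hX : (∏ k ∈ Finset.univ.erase i, wtB (X i - X k)) ≠ 0 := Finset.prod_ne_zero_iff.2
    fun k hk h0 => Finset.ne_of_mem_erase hk (hG.wtB_left _ _ h0).symm
  have hY : (∏ k ∈ Finset.univ.erase j, wtB (Y j - Y k)) ≠ 0 := Finset.prod_ne_zero_iff.2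
    fun k hk h0 => Finset.ne_of_mem_erase hk (hG.wtB_right _ _ h0).symm
  have hXi : wtA γ (X i - μ 0) ≠ 0 ∧ wtB (X i - μ 0) ≠ 0 := hG.wt_left 0 i
  have hYj : wtA γ (Y j - μ 0) ≠ 0 ∧ wtB (Y j - μ 0) ≠ 0 := hG.wt_right 0 j
  obtain ⟨⟨hAX, hBX⟩, hAY, hBY⟩ := And.intro hXi hYj
  have hsign : ((-1 : ℂ) ^ n) ^ 2 = 1 := by rw [← pow_mul, mul_comm, pow_mul, neg_one_sq, one_pow]
  rw [Hker_succ, Ffac_consSuccAbove hf hg, Omega_eq_div_mul_Lfac (h := h) hf hg,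
    residueDenom_consSuccAbove hf, residueDenom_consSuccAbove hg]
  simp only [Function.comp_apply, consSuccAbove_zero, consSuccAbove_succ, Finset.prod_mul_distrib,
    prod_succAbove_comp hf i fun k => wtB (X i - X k) ^ 2,
    prod_succAbove_comp hg j fun k => wtB (Y j - Y k) ^ 2,
    prod_succAbove_comp hf i fun k => wtA γ (X k - μ 0),
    prod_succAbove_comp hg j fun k => wtA γ (Y k - μ 0), Finset.prod_pow,
    ← Finset.mul_prod_erase _ (fun k => wtA γ (X k - μ 0)) (Finset.mem_univ i),
    ← Finset.mul_prod_erase _ (fun k => wtA γ (Y k - μ 0)) (Finset.mem_univ j)]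
  generalize Lfac γ h μ _ _ 0 = Λ, Hker _ _ _ _ _ = H
  field_simp
  rw [hsign, mul_one]

end residueExpansion

/-- Each summand is the residue of the integrand at `w = X ∘ f`, `w̄ = Y ∘ g`. -/
theorem scalarProduct_eq_sum {γ : ℂ} {L n : ℕ} {h : n ≤ L} {μ : Fin L → ℂ} {X Y : Fin n → ℂ}
    (hG : Regular γ h μ X Y) :
    scalarProduct γ μ X Y = ∑ f : Fin n → Fin n, ∑ g : Fin n → Fin n,
      Hker γ h μ (X ∘ f) (Y ∘ g) / residueDenom X f / residueDenom Y g := by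
  induction n generalizing L with
  | zero => simp [scalarProduct, Hker, residueDenom]
  | succ n ih =>
    obtain _ | L := L
    · exact absurd h (Nat.not_succ_le_zero n)
    have expand : ∑ f : Fin (n + 1) → Fin (n + 1), ∑ g : Fin (n + 1) → Fin (n + 1),
        Hker γ h μ (X ∘ f) (Y ∘ g) / residueDenom X f / residueDenom Y g =
        ∑ i, ∑ j, ∑ f : Fin n → Fin n, ∑ g : Fin n → Fin n,
          Hker γ h μ (X ∘ consSuccAbove i f) (Y ∘ consSuccAbove j g) /
            residueDenom X (consSuccAbove i f) / residueDenom Y (consSuccAbove j g) := by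
      rw [sum_eq_sum_consSuccAbove fun f hf => Finset.sum_eq_zero fun g _ => by
        rw [Hker_comp_eq_zero (.inl hf), zero_div, zero_div]]
      refine Finset.sum_congr rfl fun i _ => ?_
      rw [Finset.sum_comm, sum_eq_sum_consSuccAbove fun g hg => Finset.sum_eq_zero fun f _ => by
        rw [Hker_comp_eq_zero (.inr hg), zero_div, zero_div]]
      exact Finset.sum_congr rfl fun j _ => Finset.sum_comm
    rw [scalarProduct_recursion_cancelled (μ := μ) (X := X) (Y := Y) (hG.wt_left 0) (hG.wt_right 0)
      (fun i k hik h0 => hik (hG.wtB_left i k h0)) (fun i k hik h0 => hik (hG.wtB_right i k h0))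
      hG.Ffac_ne_zero, expand]
    simp only [ih (hG.succAbove _ _), Finset.mul_sum]
    refine Finset.sum_congr rfl fun i _ => Finset.sum_congr rfl fun j _ =>
      Finset.sum_congr rfl fun f _ => Finset.sum_congr rfl fun g _ => ?_
    by_cases hfg : Function.Injective f ∧ Function.Injective g
    · exact (Hker_consSuccAbove_div_residueDenom hG hfg.1 hfg.2 i j).symm
    · rw [Hker_comp_eq_zero (not_and_or.1 hfg), Hker_comp_eq_zero]
      · simp only [zero_div, mul_zero]
      · refine (not_and_or.1 hfg).imp (mt fun hinj k l hkl => ?_) (mt fun hinj k l hkl => ?_)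
        · exact Fin.succ_injective _ (hinj (by simp [hkl]))
        · exact Fin.succ_injective _ (hinj (by simp [hkl]))

/-! ### The integral formula -/

lemma dense_regular {γ : ℂ} (hc : wtC γ ≠ 0) {L n : ℕ} (h : n ≤ L) (μ : Fin L → ℂ) :
    Dense {p : (Fin n → ℂ) × (Fin n → ℂ) | Regular γ h μ p.1 p.2} := by
  obtain ⟨x, hx⟩ := (dense_wtA_sub_ne_zero γ 0).nonempty
  have hx : wtA γ x ≠ 0 := by simpa using hx
  have hwt : ∀ᶠ p : (Fin n → ℂ) × (Fin n → ℂ) in residual _, ∀ i k,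
      (wtA γ (p.1 k - μ (Fin.castLE h i)) ≠ 0 ∧ wtB (p.1 k - μ (Fin.castLE h i)) ≠ 0) ∧
        wtA γ (p.2 k - μ (Fin.castLE h i)) ≠ 0 ∧ wtB (p.2 k - μ (Fin.castLE h i)) ≠ 0 := by
    refine eventually_all.2 fun i => eventually_all.2 fun k => .and (.and ?_ ?_) (.and ?_ ?_)
    · exact eventually_residual_ne_zero
        (fun p _ => analyticAt_wtA_sub γ (analyticAt_fst_apply k p) analyticAt_const)
        ⟨(fun _ => x + μ (Fin.castLE h i), 0), by simpa using hx⟩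
    · exact eventually_residual_ne_zero
        (fun p _ => analyticAt_wtB_sub (analyticAt_fst_apply k p) analyticAt_const)
        ⟨(fun _ => 1 + μ (Fin.castLE h i), 0), by simpa using wtB_one_ne_zero⟩
    · exact eventually_residual_ne_zero
        (fun p _ => analyticAt_wtA_sub γ (analyticAt_snd_apply k p) analyticAt_const)
        ⟨(0, fun _ => x + μ (Fin.castLE h i)), by simpa using hx⟩
    · exact eventually_residual_ne_zero
        (fun p _ => analyticAt_wtB_sub (analyticAt_snd_apply k p) analyticAt_const)
        ⟨(0, fun _ => 1 + μ (Fin.castLE h i)), by simpa using wtB_one_ne_zero⟩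
  refine dense_of_mem_residual ?_
  filter_upwards [eventually_residual_wtB_fst_sub, eventually_residual_wtB_snd_sub, hwt,
    eventually_residual_Rnum h μ hc] with p hX hY hwt hR
  exact ⟨hX, hY, fun i k => (hwt i k).1, fun i k => (hwt i k).2, fun f g =>
    denomsNonzero_of_Rnum_ne_zero (fun i k _ => ⟨(hwt i (f k)).1.2, (hwt i (g k)).2.2⟩) (hR f g)⟩

section contours
variable {n : ℕ} {Γ Δ : Fin n → Contour}

lemma filled_subset_closure_inter {S : Set ((Fin n → ℂ) × (Fin n → ℂ))} (hS : Dense S) :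
    {p | (∀ i, p.1 i ∈ (Γ i).filled) ∧ ∀ i, p.2 i ∈ (Δ i).filled} ⊆
      closure ({p | (∀ i, p.1 i ∈ (Γ i).filled) ∧ ∀ i, p.2 i ∈ (Δ i).filled} ∩ S) := by
  set inner : Set ((Fin n → ℂ) × (Fin n → ℂ)) :=
    (univ.pi fun i => (Γ i).inside) ×ˢ (univ.pi fun i => (Δ i).inside)
  have hopen : IsOpen inner := (isOpen_set_pi finite_univ fun i _ => (Γ i).isOpen_inside).prod
    (isOpen_set_pi finite_univ fun i _ => (Δ i).isOpen_inside)
  have hclosure : {p : (Fin n → ℂ) × (Fin n → ℂ) |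
      (∀ i, p.1 i ∈ (Γ i).filled) ∧ ∀ i, p.2 i ∈ (Δ i).filled} ⊆ closure inner := fun p hp => by
    rw [closure_prod_eq, closure_pi_set, closure_pi_set]
    exact ⟨fun i _ => (Γ i).filled_subset_closure_inside (hp.1 i),
      fun i _ => (Δ i).filled_subset_closure_inside (hp.2 i)⟩
  refine hclosure.trans (closure_minimal ((hS.open_subset_closure_inter hopen).trans
    (closure_mono (inter_subset_inter_left _ fun p hp => ?_))) isClosed_closure)
  exact ⟨fun i => (Γ i).inside_subset_filled (hp.1 i trivial),
    fun i => (Δ i).inside_subset_filled (hp.2 i trivial)⟩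

variable {γ : ℂ} {L : ℕ} {h : n ≤ L} {μ : Fin L → ℂ} {lamC lamB : Fin n → ℂ}

lemma Admissible.exists_extension (ha : Admissible γ h μ lamC lamB Γ Δ) (hc : wtC γ ≠ 0) :
    ∃ G : (Fin n → ℂ) × (Fin n → ℂ) → ℂ,
      AnalyticOnNhd ℂ G {p | (∀ i, p.1 i ∈ (Γ i).filled) ∧ ∀ i, p.2 i ∈ (Δ i).filled} ∧
      ∀ w v : Fin n → ℂ, (∀ i, w i ∈ (Γ i).filled) → (∀ i, v i ∈ (Δ i).filled) →
        DenomsNonzero γ h μ w v → G (w, v) = Hker γ h μ w v := by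
  obtain ⟨G, hG, hH⟩ := ha.holomorphic
  have hregular : EqOn (fun p => G p * ∏ i, Rnum γ h μ p.1 p.2 i) (fun p => Hnum γ h μ p.1 p.2)
      ({p | (∀ i, p.1 i ∈ (Γ i).filled) ∧ ∀ i, p.2 i ∈ (Δ i).filled} ∩
        {p | Regular γ h μ p.1 p.2}) := by
    rintro ⟨w, v⟩ ⟨⟨hw, hv⟩, hreg : Regular γ h μ w v⟩
    have hD : DenomsNonzero γ h μ w v := hreg.denomsNonzero id id
    dsimp only
    rw [hH w v hw hv hD fun i k hik => ⟨mt (hreg.wtB_left i k) hik, mt (hreg.wtB_right i k) hik⟩,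
      Hker_eq_div_of_denomsNonzero hD]
    exact div_mul_cancel₀ _ (Finset.prod_ne_zero_iff.2 fun i _ =>
      Rnum_ne_zero_of_denomsNonzero hD i)
  have hRcont : Continuous fun p : (Fin n → ℂ) × (Fin n → ℂ) => ∏ i, Rnum γ h μ p.1 p.2 i :=
    continuous_finsetProd _ fun i _ => continuous_iff_continuousAt.2 fun p =>
      (analyticAt_Rnum (analyticAt_fst_apply · p) (analyticAt_snd_apply · p) i).continuousAt
  have hHcont : Continuous fun p : (Fin n → ℂ) × (Fin n → ℂ) => Hnum γ h μ p.1 p.2 :=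
    continuous_iff_continuousAt.2 fun p =>
      (analyticAt_Hnum (analyticAt_fst_apply · p) (analyticAt_snd_apply · p)).continuousAt
  have hnum := hregular.of_subset_closure (hG.continuousOn.mul hRcont.continuousOn)
    hHcont.continuousOn inter_subset_left (filled_subset_closure_inter (dense_regular hc h μ))
  refine ⟨G, hG, fun w v hw hv hD => ?_⟩
  rw [Hker_eq_div_of_denomsNonzero hD]
  exact eq_div_of_mul_eq (Finset.prod_ne_zero_iff.2 fun i _ => Rnum_ne_zero_of_denomsNonzero hD i)
    (hnum (x := (w, v)) ⟨hw, hv⟩)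

/-- The tuples `X` such that every contour of `Γ` encloses all `X j` and no other zero of
`b(z - X j)`. The second condition is phrased through the nonvanishing of an entire function, so
that the set is visibly open. -/
def poleDomain (Γ : Fin n → Contour) : Set (Fin n → ℂ) :=
  {X | ∀ i j, X j ∈ (Γ i).inside ∧ ∀ z ∈ (Γ i).filled, sinhDiv (z - X j) ≠ 0}

lemma mem_poleDomain {X : Fin n → ℂ} (mem : ∀ i j, X j ∈ (Γ i).inside)
    (only : ∀ i, ∀ z ∈ (Γ i).filled, ∀ j, wtB (z - X j) = 0 → z = X j) : X ∈ poleDomain Γ :=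
  fun i j => ⟨mem i j, fun z hz => sinhDiv_ne_zero_iff.2 fun h0 =>
    sub_eq_zero.2 (only i z hz j h0)⟩

lemma isOpen_poleDomain (Γ : Fin n → Contour) : IsOpen (poleDomain Γ) := by
  refine isOpen_iff_eventually.2 fun X hX => eventually_all.2 fun i => eventually_all.2 fun j =>
    .and ?_ ?_
  · exact (continuous_apply j).continuousAt.eventually ((Γ i).isOpen_inside.mem_nhds (hX i j).1)
  · refine (Γ i).isCompact_filled.eventually_forall_of_forall_eventually fun z hz => ?_
    have hcont : Continuous fun p : (Fin n → ℂ) × ℂ => sinhDiv (p.2 - p.1 j) :=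
      differentiable_sinhDiv.continuous.comp (by fun_prop)
    exact hcont.continuousAt.eventually_ne ((hX i j).2 z hz)

lemma eq_of_mem_poleDomain {X : Fin n → ℂ} (hX : X ∈ poleDomain Γ) (i : Fin n) (z : ℂ)
    (hz : z ∈ (Γ i).filled) (j : Fin n) (h0 : wtB (z - X j) = 0) : z = X j :=
  sub_eq_zero.1 (sinhDiv_ne_zero_iff.1 ((hX i j).2 z hz) h0)

lemma wtB_sub_ne_zero_of_mem_poleDomain {X : Fin n → ℂ} (hX : X ∈ poleDomain Γ) {i j : Fin n}
    {z : ℂ} (hz : z ∈ (Γ i).trace) : wtB (z - X j) ≠ 0 := fun h0 =>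
  Contour.ne_of_mem_trace_of_mem_inside hz (hX i j).1
    (eq_of_mem_poleDomain hX i z ((Γ i).trace_subset_filled hz) j h0)

variable {G : (Fin n → ℂ) × (Fin n → ℂ) → ℂ}

lemma continuousOn_multiIntegral_poleDomain
    (hG : ContinuousOn G {p | (∀ i, p.1 i ∈ (Γ i).filled) ∧ ∀ i, p.2 i ∈ (Δ i).filled}) :
    ContinuousOn (fun p : (Fin n → ℂ) × (Fin n → ℂ) =>
      multiIntegral Γ fun w => multiIntegral Δ fun v =>
        G (w, v) / ∏ i, ∏ j, wtB (w i - p.1 j) * wtB (v i - p.2 j))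
      (poleDomain Γ ×ˢ poleDomain Δ) := by
  rw [continuousOn_iff_continuous_domRestrict]
  refine continuous_multiIntegral (X := ↥(poleDomain Γ ×ˢ poleDomain Δ)) Γ
    (F := fun p w => multiIntegral Δ fun v =>
      G (w, v) / ∏ i, ∏ j, wtB (w i - p.1.1 j) * wtB (v i - p.1.2 j)) ?_
  refine continuous_multiIntegral
    (X := ↥(poleDomain Γ ×ˢ poleDomain Δ) × {w : Fin n → ℂ // ∀ i, w i ∈ (Γ i).trace}) Δ
    (F := fun p v => G (p.2.1, v) / ∏ i, ∏ j, wtB (p.2.1 i - p.1.1.1 j) * wtB (v i - p.1.1.2 j)) ?_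
  refine Continuous.div ?_ (continuous_finsetProd _ fun i _ => continuous_finsetProd _ fun j _ =>
    (continuous_wtB.comp (.sub ?_ ?_)).mul (continuous_wtB.comp (.sub ?_ ?_))) fun p => ?_
  · exact hG.comp_continuous (by fun_prop)
      fun p => ⟨fun i => (Γ i).trace_subset_filled (p.1.2.2 i),
        fun i => (Δ i).trace_subset_filled (p.2.2 i)⟩
  · exact (continuous_apply i).comp (g := fun w : Fin n → ℂ => w i) (by fun_prop)
  · exact (continuous_apply j).comp (g := fun X : Fin n → ℂ => X j) (by fun_prop)
  · exact (continuous_apply i).comp (g := fun v : Fin n → ℂ => v i) (by fun_prop)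
  · exact (continuous_apply j).comp (g := fun Y : Fin n → ℂ => Y j) (by fun_prop)
  · exact Finset.prod_ne_zero_iff.2 fun i _ => Finset.prod_ne_zero_iff.2 fun j _ => mul_ne_zero
      (wtB_sub_ne_zero_of_mem_poleDomain p.1.1.2.1 (p.1.2.2 i))
      (wtB_sub_ne_zero_of_mem_poleDomain p.1.1.2.2 (p.2.2 i))

lemma residueDenom_ne_zero {m : ℕ} {X : Fin n → ℂ} (hX : ∀ j k, wtB (X j - X k) = 0 → j = k)
    (f : Fin m → Fin n) : residueDenom X f ≠ 0 :=
  Finset.prod_ne_zero_iff.2 fun _ _ => Finset.prod_ne_zero_iff.2 fun _ hk h0 =>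
    Finset.ne_of_mem_erase hk (hX _ _ h0).symm

lemma multiIntegral_eq_sum {X Y : Fin n → ℂ}
    (hG : AnalyticOnNhd ℂ G {p | (∀ i, p.1 i ∈ (Γ i).filled) ∧ ∀ i, p.2 i ∈ (Δ i).filled})
    (hX : X ∈ poleDomain Γ) (hY : Y ∈ poleDomain Δ)
    (hXb : ∀ j k, wtB (X j - X k) = 0 → j = k) (hYb : ∀ j k, wtB (Y j - Y k) = 0 → j = k) :
    (multiIntegral Γ fun w => multiIntegral Δ fun v =>
      G (w, v) / ∏ i, ∏ j, wtB (w i - X j) * wtB (v i - Y j)) =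
    ∑ f : Fin n → Fin n, ∑ g : Fin n → Fin n,
      G (X ∘ f, Y ∘ g) / residueDenom X f / residueDenom Y g := by
  have injective {Z : Fin n → ℂ} (hZ : ∀ j k, wtB (Z j - Z k) = 0 → j = k) :
      Function.Injective Z := fun j k hjk => hZ j k (by rw [hjk, sub_self, wtB_zero])
  have inner (w : Fin n → ℂ) (hw : ∀ i, w i ∈ (Γ i).trace) :
      (multiIntegral Δ fun v => G (w, v) / ∏ i, ∏ j, wtB (w i - X j) * wtB (v i - Y j)) =
      (∑ g : Fin n → Fin n, G (w, Y ∘ g) / residueDenom Y g) / ∏ i, ∏ j, wtB (w i - X j) := by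
    have hGw : AnalyticOnNhd ℂ (fun v => G (w, v)) {v | ∀ i, v i ∈ (Δ i).filled} := fun v hv =>
      (hG (w, v) ⟨fun i => (Γ i).trace_subset_filled (hw i), hv⟩).fun_comp
        (f := fun v => (w, v)) (analyticAt_const.prod analyticAt_id)
    rw [← multiIntegral_div_prod_wtB (injective hYb) (fun i j => (hY i j).1)
      (eq_of_mem_poleDomain hY) hGw, div_eq_inv_mul, ← multiIntegral_const_mul]
    simp only [Finset.prod_mul_distrib, div_eq_inv_mul, mul_inv, mul_assoc]
  rw [multiIntegral_congr Γ inner, multiIntegral_div_prod_wtB (injective hXb)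
    (fun i j => (hX i j).1) (eq_of_mem_poleDomain hX)]
  · simp only [Finset.sum_div, div_right_comm]
  · refine fun w hw => Finset.analyticAt_fun_sum _ fun g _ => ?_
    exact ((hG (w, Y ∘ g) ⟨hw, fun i => (Δ i).inside_subset_filled (hY i (g i)).1⟩).fun_comp
      (f := fun w => (w, Y ∘ g)) (analyticAt_id.prod analyticAt_const)).fun_div analyticAt_const
      (residueDenom_ne_zero hYb g)

/-- The right-hand side is a sum of residues for regular `X, Y`, and both sides are continuous. -/
lemma scalarProduct_eq_multiIntegral_extension (hc : wtC γ ≠ 0) {X Y : Fin n → ℂ}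
    (hG : AnalyticOnNhd ℂ G {p | (∀ i, p.1 i ∈ (Γ i).filled) ∧ ∀ i, p.2 i ∈ (Δ i).filled})
    (hH : ∀ w v : Fin n → ℂ, (∀ i, w i ∈ (Γ i).filled) → (∀ i, v i ∈ (Δ i).filled) →
      DenomsNonzero γ h μ w v → G (w, v) = Hker γ h μ w v)
    (hX : X ∈ poleDomain Γ) (hY : Y ∈ poleDomain Δ) :
    scalarProduct γ μ X Y = multiIntegral Γ fun w => multiIntegral Δ fun v =>
      G (w, v) / ∏ i, ∏ j, wtB (w i - X j) * wtB (v i - Y j) := by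
  have hregular : EqOn (fun p => scalarProduct γ μ p.1 p.2)
      (fun p => multiIntegral Γ fun w => multiIntegral Δ fun v =>
        G (w, v) / ∏ i, ∏ j, wtB (w i - p.1 j) * wtB (v i - p.2 j))
      ((poleDomain Γ ×ˢ poleDomain Δ) ∩ {p | Regular γ h μ p.1 p.2}) := by
    rintro ⟨X, Y⟩ ⟨⟨hX, hY⟩, hreg : Regular γ h μ X Y⟩
    dsimp only
    rw [scalarProduct_eq_sum hreg, multiIntegral_eq_sum hG hX hY hreg.wtB_left hreg.wtB_right]
    refine Finset.sum_congr rfl fun f _ => Finset.sum_congr rfl fun g _ => ?_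
    rw [hH (X ∘ f) (Y ∘ g) (fun i => (Γ i).inside_subset_filled (hX i (f i)).1)
      (fun i => (Δ i).inside_subset_filled (hY i (g i)).1) (hreg.denomsNonzero f g)]
  have hopen : IsOpen (poleDomain Γ ×ˢ poleDomain Δ) :=
    (isOpen_poleDomain Γ).prod (isOpen_poleDomain Δ)
  have heq := hregular.of_subset_closure
    (continuous_scalarProduct continuous_const continuous_fst continuous_snd).continuousOn
    (continuousOn_multiIntegral_poleDomain hG.continuousOn) inter_subset_left
    ((dense_regular hc h μ).open_subset_closure_inter hopen)
  exact heq (x := (X, Y)) ⟨hX, hY⟩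

theorem Admissible.scalarProduct_eq_multiIntegral (ha : Admissible γ h μ lamC lamB Γ Δ) :
    scalarProduct γ μ lamC lamB = multiIntegral Γ fun w => multiIntegral Δ fun v =>
      Hker γ h μ w v / ∏ i, ∏ j, wtB (w i - lamC j) * wtB (v i - lamB j) := by
  by_cases hc : wtC γ = 0
  · obtain _ | n := n
    · simp [scalarProduct, multiIntegral, Hker]
    · simp [scalarProduct_eq_zero μ hc, Hker, hc, multiIntegral_zero]
  obtain ⟨G, hG, hH⟩ := ha.exists_extension hc
  rw [scalarProduct_eq_multiIntegral_extension hc hG hH (mem_poleDomain ha.mem_C ha.only_C)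
    (mem_poleDomain ha.mem_B ha.only_B)]
  refine multiIntegral_congr _ fun w hw => multiIntegral_congr _ fun v hv => ?_
  rw [hH w v (fun i => (Γ i).trace_subset_filled (hw i))
    (fun i => (Δ i).trace_subset_filled (hv i)) (ha.on_contour w v hw hv)]

end contours

end SixVertex

end

theorem mainTheorem1 (γ : ℂ) :
    -- the multiple contour integral formula, for all admissible contours
    (∀ (L n : ℕ) (h : n ≤ L) (μ : Fin L → ℂ) (lamC lamB : Fin n → ℂ) (Γ Δ : Fin n → Contour),
      Admissible γ h μ lamC lamB Γ Δ →
      scalarProduct γ μ lamC lamB =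
        multiIntegral Γ fun w => multiIntegral Δ fun v =>
          Hker γ h μ w v / ∏ i, ∏ j, wtB (w i - lamC j) * wtB (v i - lamB j)) ∧
    -- such contours exist for `λ` in generic position, and generic position is a dense condition
    (∀ (L n : ℕ) (h : n ≤ L) (μ : Fin L → ℂ) (lamC lamB : Fin n → ℂ),
      Generic γ h μ lamC lamB → ∃ Γ Δ : Fin n → Contour, Admissible γ h μ lamC lamB Γ Δ) ∧
    (Complex.sinh γ ≠ 0 → ∀ (L n : ℕ) (h : n ≤ L) (μ : Fin L → ℂ),
      Dense {p : (Fin n → ℂ) × (Fin n → ℂ) | Generic γ h μ p.1 p.2}) ∧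
    -- the kernel for `n = 1`
    (∀ (L : ℕ) (h : 1 ≤ L + 1) (μ : Fin (L + 1) → ℂ) (w v : ℂ),
      Hker γ h μ ![w] ![v] =
        wtC γ ^ 2 * ((∏ k, wtA γ (w - μ k) * wtB (v - μ k)) - ∏ k, wtA γ (v - μ k) * wtB (w - μ k))
          / (wtB (w - μ 0) * wtB (v - μ 0)
            * (wtA γ (w - μ 0) / wtB (w - μ 0) - wtA γ (v - μ 0) / wtB (v - μ 0)))) ∧
    -- the recursion for the kernel
    (∀ (L n : ℕ) (h : n ≤ L) (μ : Fin (L + 1) → ℂ),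
      (∀ k : Fin L, wtA γ (μ 0 - μ k.succ) ≠ 0 ∧ wtA γ (μ k.succ - μ 0) ≠ 0) →
      ∀ w v : Fin (n + 1) → ℂ, DenomsNonzero γ (Nat.succ_le_succ h) μ w v →
      (∀ i k, i ≠ k → wtB (w i - w k) ≠ 0 ∧ wtB (v i - v k) ≠ 0) →
      Hker γ (Nat.succ_le_succ h) μ w v =
        Hbar γ h μ (fun k => w k.succ) (fun k => v k.succ) / (wtB (w 0 - μ 0) * wtB (v 0 - μ 0))
        * (∏ k : Fin n, wtB (w 0 - w k.succ) ^ 2 * wtB (v 0 - v k.succ) ^ 2)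
        * ((∏ k : Fin n, wtA γ (w k.succ - μ 0) * wtA γ (v k.succ - μ 0))
            / ∏ k : Fin L, wtA γ (μ 0 - μ k.succ) * wtA γ (μ k.succ - μ 0))
        * (Ffac γ μ w v)⁻¹
        * ((∏ k, wtA γ (v 0 - μ k) * wtB (μ k - w 0))
              * (∏ k : Fin n, wtA γ (w 0 - w k.succ) / wtB (w 0 - w k.succ))
              * (∏ k : Fin n, wtA γ (v k.succ - v 0) / wtB (v k.succ - v 0))
            - (∏ k, wtA γ (w 0 - μ k) * wtB (μ k - v 0))
              * (∏ k : Fin n, wtA γ (w k.succ - w 0) / wtB (w k.succ - w 0))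
              * (∏ k : Fin n, wtA γ (v 0 - v k.succ) / wtB (v 0 - v k.succ)))) ∧
    -- the function `V` arises from the scalar product by specialisation
    (∀ (L n : ℕ) (_ : n ≤ L) (μ : Fin (L + 1) → ℂ) (X Y : Fin n → ℂ),
      scalarProduct γ μ (Fin.cons (μ 0 - γ) X : Fin (n + 1) → ℂ)
          (Fin.cons (μ 0) Y : Fin (n + 1) → ℂ) =
        (∏ j, wtB (X j - μ 0) * wtA γ (Y j - μ 0)) * Vfun γ μ X Y) ∧
    -- the recursion for the scalar product
    (∀ (L n : ℕ) (_ : n ≤ L) (μ : Fin (L + 1) → ℂ) (lamC lamB : Fin (n + 1) → ℂ),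
      (∀ k : Fin L, wtA γ (μ 0 - μ k.succ) ≠ 0 ∧ wtA γ (μ k.succ - μ 0) ≠ 0) →
      (∀ i, wtA γ (lamC i - μ 0) ≠ 0 ∧ wtB (lamC i - μ 0) ≠ 0) →
      (∀ i, wtA γ (lamB i - μ 0) ≠ 0 ∧ wtB (lamB i - μ 0) ≠ 0) →
      (∀ i k, i ≠ k → wtB (lamC i - lamC k) ≠ 0 ∧ wtB (lamB i - lamB k) ≠ 0) →
      Ffac γ μ lamC lamB ≠ 0 →
      scalarProduct γ μ lamC lamB =
        Kfac γ μ lamC lamB * ∑ i, ∑ j, Omega γ μ lamC lamB i j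
          * Vfun γ μ (fun k => lamC (i.succAbove k)) (fun k => lamB (j.succAbove k))) := by
  exact ⟨fun _ _ _ _ _ _ _ _ ha => ha.scalarProduct_eq_multiIntegral,
    fun _ _ _ _ _ _ hG => hG.exists_admissible,
    fun hc _ _ h μ => dense_generic h μ hc,
    fun _ h μ w v => Hker_one γ h μ w v,
    fun _ _ h μ hμ w v _ _ =>
      (Hker_eq_Hbar_mul γ (Nat.succ_le_succ h) μ w v hμ).trans (by rw [Lfac_zero]),
    fun _ _ _ μ X Y => scalarProduct_special_left X Y,
    fun _ _ _ μ X Y hμ hX hY hne hF => scalarProduct_recursion X Y hμ hX hY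
      (fun i k hik => (hne i k hik).1) (fun i k hik => (hne i k hik).2) hF⟩
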